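/- Let $\mathcal E$ be a locally cartesian closed category with a terminal object (with pullbacks, binary products and the right adjoints below chosen arbitrarily). For $f:B\to A$ write $f^*:\mathcal E/A\to\mathcal E/B$ for pullback along $f$, and $f_!\dashv f^*\dashv f_*$ for its left adjoint (composition with $f$) and its right adjoint. A polynomial $F$ from $I$ to $J$ is a diagram $I\xleftarrow{s}B\xrightarrow{f}A\xrightarrow{t}J$ in $\mathcal E$; its extension is the polynomial functor $P_F=t_!\,f_*\,s^*:\mathcal E/I\to\mathcal E/J$. The slice $\mathcal E/I$ is tensored over $\mathcal E$ by $K\otimes(X\to I)=(K\times X\to X\to I)$, a strength on a functor $P$ is a natural family $K\otimes P(X)\to P(K\otimes X)$ satisfying the unit and associativity axioms, and $P_F$ carries the strength composed of the canonical strengths of $s^*$, $f_*$ and $t_!$. A natural transformation between functors with strength is strong if it commutes with the strengths. Let $G=(I\xleftarrow{u}D\xrightarrow{g}C\xrightarrow{v}J)$ and $F=(I\xleftarrow{s}B\xrightarrow{f}A\xrightarrow{t}J)$ be polynomials from $I$ to $J$. A morphism $G\to F$ is a tuple $(E,p,w,\beta,\alpha)$ of an object $E$ and maps $p:E\to C$,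 $w:E\to D$, $\beta:E\to B$, $\alpha:C\to A$ such that $g w=p$, $u w=s\beta$, $t\alpha=v$, and $$\begin{array}{ccc}E&\xrightarrow{\;p\;}&C\\ {\scriptstyle\beta}\downarrow&&\downarrow{\scriptstyle\alpha}\\ B&\xrightarrow{\;f\;}&A\end{array}$$ is a pullback square. Put $M=(I\xleftarrow{uw}E\xrightarrow{p}C\xrightarrow{v}J)$. The morphism induces two natural transformations, where $\eta$ is the unit of $w^*\dashv w_*$ and $\varepsilon$ is the counit of $\alpha_!\dashv\alpha^*$: $$P_G=v_!g_*u^*\xrightarrow{\ \eta\ }v_!g_*w_*w^*u^*\cong v_!p_*(uw)^*=P_M,$$ $$P_M=v_!p_*(uw)^*\cong v_!p_*\beta^*s^*\cong v_!\alpha^*f_*s^*=t_!\alpha_!\alpha^*f_*s^*\xrightarrow{\ \varepsilon\ }t_!f_*s^*=P_F,$$ using the Beck--Chevalley isomorphism $p_*\beta^*\cong\alpha^*f_*$. It is said to represent the composite $P_G\Rightarrow P_M\Rightarrow P_F$. **Theorem.** 1. For every morphism $G\to F$, the transformation $P_G\Rightarrow P_M$ is strong and vertical (its component at the terminal object $\mathrm{id}_I$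 of $\mathcal E/I$ is the identity of $v:C\to J$, under the canonical isomorphisms $P_G(1)\cong v\cong P_M(1)$), the transformation $P_M\Rightarrow P_F$ is strong and cartesian (all its naturality squares are pullbacks), and the composite $P_G\Rightarrow P_F$ is strong. 2. Every strong natural transformation $\phi:P_G\Rightarrow P_F$ is represented by a morphism $G\to F$, and this morphism is essentially unique: there is a morphism $(E,p,w,\beta,\alpha)$ representing $\phi$ such that for every morphism $(E',p',w',\beta',\alpha')$ representing $\phi$ one has $\alpha=\alpha'$ and there is exactly one isomorphism $e:E\to E'$ with $p'e=p$, $w'e=w$ and $\beta'e=\beta$. -/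

import Mathlib

open CategoryTheory

namespace PolyFun

open MonoidalCategory CartesianMonoidalCategory

universe v u

/-- A (chosen) right adjoint to every pullback functor.  Together with chosen pullbacks, this makes
every slice of `C` cartesian closed. -/
abbrev LocallyCartesianClosed (C : Type u) [Category.{v} C] [ChosenPullbacks C] :=
  ∀ {X Y : C} (f : X ⟶ Y), ExponentiableMorphism f

section Strength

variable {C : Type u} [Category.{v} C] [CartesianMonoidalCategory C]

/-- The tensoring of the slice over `I` over `C`: the object `K × X ⟶ X ⟶ I`. -/
abbrev tens {I : C} (K : C) (X : Over I) : Over I :=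
  Over.mk (snd K X.left ≫ X.hom)

/-- The functoriality of the tensoring. -/
abbrev tensMap {I : C} {K L : C} {X Y : Over I} (k : K ⟶ L) (g : X ⟶ Y) :
    tens K X ⟶ tens L Y :=
  Over.homMk (k ⊗ₘ g.left) (by simp)

lemma tensMap_comp {I : C} {K L M : C} {X Y Z : Over I} (k : K ⟶ L) (l : L ⟶ M) (g : X ⟶ Y)
    (h : Y ⟶ Z) : tensMap k g ≫ tensMap l h = tensMap (k ≫ l) (g ≫ h) := by
  ext; simp

/-- The unit isomorphism `1 × X ⟶ X` of the tensoring. -/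
abbrev tensUnit {I : C} (X : Over I) : tens (𝟙_ C) X ⟶ X :=
  Over.homMk (λ_ X.left).hom (by simp [leftUnitor_hom])

/-- The associativity isomorphism `(K × L) × X ⟶ K × (L × X)` of the tensoring. -/
abbrev tensAssoc {I : C} (K L : C) (X : Over I) :
    tens (K ⊗ L) X ⟶ tens K (tens L X) :=
  Over.homMk (α_ K L X.left).hom (by simp)

/-- A tensorial strength on a functor between slices. -/
structure Strength {I J : C} (F : Over I ⥤ Over J) where
  app (K : C) (X : Over I) : tens K (F.obj X) ⟶ F.obj (tens K X)
  naturality {K L : C} {X Y : Over I} (k : K ⟶ L) (g : X ⟶ Y) :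
    tensMap k (F.map g) ≫ app L Y = app K X ≫ F.map (tensMap k g)
  unit (X : Over I) : app (𝟙_ C) X ≫ F.map (tensUnit X) = tensUnit (F.obj X)
  assoc (K L : C) (X : Over I) :
    app (K ⊗ L) X ≫ F.map (tensAssoc K L X) =
      tensAssoc K L (F.obj X) ≫ tensMap (𝟙 K) (app L X) ≫ app K (tens L X)

/-- A natural transformation between strong functors is strong if it commutes with the strengths. -/
def IsStrong {I J : C} {F G : Over I ⥤ Over J} (σ : Strength F) (τ : Strength G) (φ : F ⟶ G) :
    Prop :=
  ∀ (K : C) (X : Over I), σ.app K X ≫ φ.app (tens K X) = tensMap (𝟙 K) (φ.app X) ≫ τ.app K X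

/-- The composite strength. -/
def Strength.comp {I J K : C} {F : Over I ⥤ Over J} {G : Over J ⥤ Over K} (σ : Strength F)
    (τ : Strength G) : Strength (F ⋙ G) where
  app K X := τ.app K (F.obj X) ≫ G.map (σ.app K X)
  naturality k g := by
    have h1 := τ.naturality k (F.map g)
    have h2 := congrArg G.map (σ.naturality k g)
    simp only [Functor.map_comp] at h2
    simp only [Functor.comp_map, Functor.comp_obj, Category.assoc]
    rw [← h2, reassoc_of% h1]
  unit X := by
    have h1 := τ.unit (F.obj X)
    have h2 := congrArg G.map (σ.unit X)
    simp only [Functor.map_comp] at h2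
    simp only [Functor.comp_map, Functor.comp_obj, Category.assoc]
    rw [h2, h1]
  assoc K L X := by
    have h1 := τ.assoc K L (F.obj X)
    have h2 := congrArg G.map (σ.assoc K L X)
    have h3 := τ.naturality (𝟙 K) (σ.app L X)
    have h4 : tensMap (𝟙 K) (τ.app L (F.obj X) ≫ G.map (σ.app L X)) =
        tensMap (𝟙 K) (τ.app L (F.obj X)) ≫ tensMap (𝟙 K) (G.map (σ.app L X)) := by
      ext; simp
    simp only [Functor.map_comp] at h2
    simp only [Functor.comp_map, Functor.comp_obj, Category.assoc]
    rw [h2, reassoc_of% h1, h4, Category.assoc, reassoc_of% h3]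

/-- The strength of the dependent sum functor: the identity of `K × X`. -/
def strengthMap {A J : C} (t : A ⟶ J) : Strength (Over.map t) where
  app K X := Over.homMk (𝟙 (K ⊗ X.left)) (by simp)
  naturality k g := by ext; simp
  unit X := by ext; simp
  assoc K L X := by ext; simp

end Strength

section Pullback

variable {C : Type u} [Category.{v} C] [ChosenPullbacks C]

/-- The pullback functor along `f`. -/
abbrev pb {B A : C} (f : B ⟶ A) : Over A ⥤ Over B := ChosenPullbacksAlong.pullback f

/-- The projection `X ×_A B ⟶ X` of the chosen pullback. -/
def pbFst {B A : C} (f : B ⟶ A) (X : Over A) : ((pb f).obj X).left ⟶ X.left :=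
  ChosenPullbacksAlong.fst X.hom f

lemma pb_condition {B A : C} (f : B ⟶ A) (X : Over A) :
    pbFst f X ≫ X.hom = ((pb f).obj X).hom ≫ f :=
  ChosenPullbacksAlong.condition (f := X.hom) (g := f)

lemma pb_ext {B A : C} (f : B ⟶ A) (X : Over A) {Z : C} {a b : Z ⟶ ((pb f).obj X).left}
    (h₁ : a ≫ pbFst f X = b ≫ pbFst f X)
    (h₂ : a ≫ ((pb f).obj X).hom = b ≫ ((pb f).obj X).hom) : a = b :=
  ChosenPullbacksAlong.hom_ext X.hom f h₁ h₂

/-- The morphism into the pullback `X ×_A B` with given components. -/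
def pbLift {B A : C} (f : B ⟶ A) (X : Over A) {Z : C} (a : Z ⟶ X.left) (b : Z ⟶ B)
    (h : a ≫ X.hom = b ≫ f) : Z ⟶ ((pb f).obj X).left :=
  ChosenPullbacksAlong.lift (f := X.hom) (g := f) a b h

@[simp]
lemma pbLift_fst {B A : C} (f : B ⟶ A) (X : Over A) {Z : C} (a : Z ⟶ X.left) (b : Z ⟶ B)
    (h : a ≫ X.hom = b ≫ f) : pbLift f X a b h ≫ pbFst f X = a :=
  ChosenPullbacksAlong.lift_fst a b h

@[simp]
lemma pbLift_snd {B A : C} (f : B ⟶ A) (X : Over A) {Z : C} (a : Z ⟶ X.left) (b : Z ⟶ B)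
    (h : a ≫ X.hom = b ≫ f) : pbLift f X a b h ≫ ((pb f).obj X).hom = b :=
  ChosenPullbacksAlong.lift_snd a b h

@[simp]
lemma pb_map_fst {B A : C} (f : B ⟶ A) {X Y : Over A} (g : X ⟶ Y) :
    ((pb f).map g).left ≫ pbFst f Y = pbFst f X ≫ g.left :=
  congrArg CommaMorphism.left ((ChosenPullbacksAlong.mapPullbackAdj f).counit.naturality g)

@[simp]
lemma pbLift_fst_assoc {B A : C} (f : B ⟶ A) (X : Over A) {Z W : C} (a : Z ⟶ X.left) (b : Z ⟶ B)
    (h : a ≫ X.hom = b ≫ f) (k : X.left ⟶ W) : pbLift f X a b h ≫ pbFst f X ≫ k = a ≫ k := by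
  rw [← Category.assoc, pbLift_fst]

@[simp]
lemma pbLift_snd_assoc {B A : C} (f : B ⟶ A) (X : Over A) {Z W : C} (a : Z ⟶ X.left) (b : Z ⟶ B)
    (h : a ≫ X.hom = b ≫ f) (k : B ⟶ W) :
    pbLift f X a b h ≫ ((pb f).obj X).hom ≫ k = b ≫ k := by
  rw [← Category.assoc, pbLift_snd]

@[simp]
lemma pb_map_fst_assoc {B A : C} (f : B ⟶ A) {X Y : Over A} (g : X ⟶ Y) {W : C}
    (k : Y.left ⟶ W) : ((pb f).map g).left ≫ pbFst f Y ≫ k = pbFst f X ≫ g.left ≫ k := by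
  rw [← Category.assoc, pb_map_fst, Category.assoc]

/-- The isomorphism `w^* s'^* ≅ s^*` of functors for `w ≫ s' = s`. -/
def pbTriangle {B B' A : C} {w : B ⟶ B'} {s' : B' ⟶ A} {s : B ⟶ A} (h : w ≫ s' = s) :
    pb s' ⋙ pb w ≅ pb s :=
  NatIso.ofComponents
    (fun X => Over.isoMk
      { hom := pbLift s X (pbFst w _ ≫ pbFst s' X) ((pb w).obj ((pb s').obj X)).hom (by
          rw [Category.assoc, pb_condition, ← Category.assoc, pb_condition, Category.assoc, h])
        inv := pbLift w _ (pbLift s' X (pbFst s X) (((pb s).obj X).hom ≫ w) (by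
          rw [pb_condition, Category.assoc, h])) ((pb s).obj X).hom (by simp)
        hom_inv_id := by
          apply pb_ext
          · apply pb_ext
            · simp
            · simp [← pb_condition]
          · simp
        inv_hom_id := by
          apply pb_ext <;> simp }
      (by simp))
    (fun g => by
      ext
      apply pb_ext
      · simp
      · simp)

/-- The Beck-Chevalley isomorphism `β_! p^* ≅ f^* α_!` for left adjoints, given a pullback square
`β ≫ f = p ≫ α`; it is the pasting isomorphism `Y ×_{A'} E ≅ Y ×_A B`. -/
noncomputable def leftBeckChevalley {E A' B A : C} {β : E ⟶ B} {p : E ⟶ A'} {f : B ⟶ A} {α : A' ⟶ A}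
    (sq : IsPullback β p f α) : pb p ⋙ Over.map β ≅ Over.map α ⋙ pb f :=
  NatIso.ofComponents
    (fun Y => Over.isoMk
      { hom := pbLift f ((Over.map α).obj Y) (pbFst p Y) (((pb p).obj Y).hom ≫ β) (by
          have := pb_condition p Y
          simp only [Over.map_obj_hom, Category.assoc, sq.w]
          rw [← Category.assoc, this, Category.assoc])
        inv := pbLift p Y (pbFst f ((Over.map α).obj Y))
          (sq.lift ((pb f).obj ((Over.map α).obj Y)).hom
            (pbFst f ((Over.map α).obj Y) ≫ Y.hom) (by
              have := pb_condition f ((Over.map α).obj Y)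
              simp only [Over.map_obj_hom] at this
              rw [← this, Category.assoc])) (by simp)
        hom_inv_id := by
          refine pb_ext p Y ?_ ?_
          · simp
          · apply sq.hom_ext
            · simp
            · simp [pb_condition]
        inv_hom_id := by
          apply pb_ext
          · simp
          · simp }
      (by simp))
    (fun g => by
      ext
      apply pb_ext
      · simp
      · simp)

end Pullback

section PullbackStrength

variable {C : Type u} [Category.{v} C] [CartesianMonoidalCategory C] [ChosenPullbacks C]

/-- The isomorphism `f^*(K × X) ⟶ K × f^* X`. -/
def pbTens {B A : C} (f : B ⟶ A) (K : C) (X : Over A) :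
    (pb f).obj (tens K X) ⟶ tens K ((pb f).obj X) :=
  Over.homMk
    (lift (pbFst f (tens K X) ≫ fst K X.left)
      (pbLift f X (pbFst f (tens K X) ≫ snd K X.left) ((pb f).obj (tens K X)).hom (by
        simpa using pb_condition f (tens K X)))) (by simp)

lemma pbTens_naturality {B A : C} (f : B ⟶ A) {K L : C} {X Y : Over A} (k : K ⟶ L) (g : X ⟶ Y) :
    (pb f).map (tensMap k g) ≫ pbTens f L Y = pbTens f K X ≫ tensMap k ((pb f).map g) := by
  apply Over.OverMorphism.ext
  apply CartesianMonoidalCategory.hom_ext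
  · simp [pbTens]
  · apply pb_ext <;> simp [pbTens]

lemma pbTens_unit {B A : C} (f : B ⟶ A) (X : Over A) :
    pbTens f (𝟙_ C) X ≫ tensUnit ((pb f).obj X) = (pb f).map (tensUnit X) := by
  apply Over.OverMorphism.ext
  apply pb_ext <;> simp [pbTens, leftUnitor_hom]

lemma pbTens_assoc {B A : C} (f : B ⟶ A) (K L : C) (X : Over A) :
    pbTens f (K ⊗ L) X ≫ tensAssoc K L ((pb f).obj X) =
      (pb f).map (tensAssoc K L X) ≫ pbTens f K (tens L X) ≫ tensMap (𝟙 K) (pbTens f L X) := by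
  apply Over.OverMorphism.ext
  apply CartesianMonoidalCategory.hom_ext
  · simp [pbTens]
  · apply CartesianMonoidalCategory.hom_ext
    · simp [pbTens]
    · apply pb_ext <;> simp [pbTens]

/-- The strength of the pullback functor: the isomorphism `K × f^* X ⟶ f^*(K × X)`. -/
def strengthPullback {B A : C} (f : B ⟶ A) : Strength (pb f) where
  app K X := Over.homMk
    (pbLift f (tens K X) (K ◁ pbFst f X) (snd K _ ≫ ((pb f).obj X).hom)
      (by simp [pb_condition])) (by simp)
  naturality k g := by
    apply Over.OverMorphism.ext
    apply pb_ext
    · apply CartesianMonoidalCategory.hom_ext <;> simp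
    · simp
  unit X := by
    apply Over.OverMorphism.ext
    apply pb_ext
    · simp
    · simp [leftUnitor_hom]
  assoc K L X := by
    apply Over.OverMorphism.ext
    apply pb_ext
    · apply CartesianMonoidalCategory.hom_ext <;> simp
    · simp

end PullbackStrength

section Pushforward

variable {C : Type u} [Category.{v} C] [ChosenPullbacks C] [LocallyCartesianClosed C]

/-- The dependent product functor along `f`. -/
abbrev push {B A : C} (f : B ⟶ A) : Over B ⥤ Over A := ExponentiableMorphism.pushforward f

/-- The adjunction between pullback and dependent product. -/
abbrev pushAdj {B A : C} (f : B ⟶ A) : pb f ⊣ push f :=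
  ExponentiableMorphism.pullbackPushforwardAdj f

/-- The isomorphism `f'_* w_* ≅ f_*` for `w ≫ f' = f`, conjugate to `f^* ≅ w^* f'^*`. -/
def pushTriangle {B B' A : C} {w : B ⟶ B'} {f' : B' ⟶ A} {f : B ⟶ A} (h : w ≫ f' = f) :
    push w ⋙ push f' ≅ push f :=
  conjugateIsoEquiv ((pushAdj f').comp (pushAdj w)) (pushAdj f) (pbTriangle h).symm

/-- The Beck-Chevalley isomorphism `α^* f_* ≅ p_* β^*` of a pullback square `β ≫ f = p ≫ α`,
conjugate to the isomorphism `β_! p^* ≅ f^* α_!` of left adjoints. -/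
noncomputable def beckChevalley {E A' B A : C} {β : E ⟶ B} {p : E ⟶ A'} {f : B ⟶ A} {α : A' ⟶ A}
    (sq : IsPullback β p f α) : push f ⋙ pb α ≅ pb β ⋙ push p :=
  conjugateIsoEquiv ((ChosenPullbacksAlong.mapPullbackAdj α).comp (pushAdj f))
    ((pushAdj p).comp (ChosenPullbacksAlong.mapPullbackAdj β)) (leftBeckChevalley sq)

lemma push_ext {B A : C} (f : B ⟶ A) {X : Over A} {Y : Over B} {a b : X ⟶ (push f).obj Y}
    (h : (pb f).map a ≫ (pushAdj f).counit.app Y = (pb f).map b ≫ (pushAdj f).counit.app Y) :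
    a = b := by
  apply ((pushAdj f).homEquiv _ _).symm.injective
  rwa [Adjunction.homEquiv_counit, Adjunction.homEquiv_counit]

end Pushforward

section PushforwardStrength

variable {C : Type u} [Category.{v} C] [CartesianMonoidalCategory C] [ChosenPullbacks C]
  [LocallyCartesianClosed C]

/-- The components `K × f_* Y ⟶ f_*(K × Y)` of the strength of the dependent product functor:
the adjoint transposes of `f^*(K × f_* Y) ≅ K × f^* f_* Y ⟶ K × Y`. -/
def pushStrengthApp {B A : C} (f : B ⟶ A) (K : C) (Y : Over B) :
    tens K ((push f).obj Y) ⟶ (push f).obj (tens K Y) :=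
  (pushAdj f).homEquiv _ _
    (pbTens f K ((push f).obj Y) ≫ tensMap (𝟙 K) ((pushAdj f).counit.app Y))

lemma pushStrengthApp_counit {B A : C} (f : B ⟶ A) (K : C) (Y : Over B) :
    (pb f).map (pushStrengthApp f K Y) ≫ (pushAdj f).counit.app (tens K Y) =
      pbTens f K ((push f).obj Y) ≫ tensMap (𝟙 K) ((pushAdj f).counit.app Y) := by
  have h := (pushAdj f).homEquiv_counit (g := pushStrengthApp f K Y)
  rw [pushStrengthApp, Equiv.symm_apply_apply] at h
  exact h.symm

/-- The strength of the dependent product functor. -/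
def strengthPush {B A : C} (f : B ⟶ A) : Strength (push f) where
  app K Y := pushStrengthApp f K Y
  naturality {K L X Y} k g := by
    apply push_ext
    have h : (pb f).map ((push f).map (tensMap k g)) ≫ (pushAdj f).counit.app (tens L Y) =
      (pushAdj f).counit.app (tens K X) ≫ tensMap k g := (pushAdj f).counit.naturality (tensMap k g)
    have h' : (pb f).map ((push f).map g) ≫ (pushAdj f).counit.app Y =
      (pushAdj f).counit.app X ≫ g := (pushAdj f).counit.naturality g
    rw [Functor.map_comp, Functor.map_comp, Category.assoc, Category.assoc, h,
      pushStrengthApp_counit, reassoc_of% pushStrengthApp_counit,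
      reassoc_of% pbTens_naturality, tensMap_comp, tensMap_comp, h']
    simp
  unit X := by
    apply push_ext
    have h : (pb f).map ((push f).map (tensUnit X)) ≫ (pushAdj f).counit.app X =
      (pushAdj f).counit.app (tens (𝟙_ C) X) ≫ tensUnit X := (pushAdj f).counit.naturality _
    rw [Functor.map_comp, Category.assoc, h, reassoc_of% pushStrengthApp_counit, ← pbTens_unit,
      Category.assoc]
    congr 1
    ext
    simp
  assoc K L X := by
    apply push_ext
    have h : (pb f).map ((push f).map (tensAssoc K L X)) ≫
        (pushAdj f).counit.app (tens K (tens L X)) =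
      (pushAdj f).counit.app (tens (K ⊗ L) X) ≫ tensAssoc K L X := (pushAdj f).counit.naturality _
    have e : tensMap (𝟙 (K ⊗ L)) ((pushAdj f).counit.app X) ≫ tensAssoc K L X =
        tensAssoc K L ((pb f).obj ((push f).obj X)) ≫
          tensMap (𝟙 K) (tensMap (𝟙 L) ((pushAdj f).counit.app X)) := by
      ext; simp
    rw [Functor.map_comp, Functor.map_comp, Functor.map_comp, Category.assoc, Category.assoc,
      Category.assoc, h, reassoc_of% pushStrengthApp_counit, pushStrengthApp_counit, e,
      reassoc_of% pbTens_assoc, reassoc_of% pbTens_naturality, tensMap_comp, tensMap_comp,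
      pushStrengthApp_counit]

end PushforwardStrength

section Polynomials

variable {C : Type u} [Category.{v} C]

/-- A polynomial from `I` to `J`: a diagram `I ⟵ B ⟶ A ⟶ J`. -/
structure Poly (I J : C) where
  B : C
  A : C
  s : B ⟶ I
  f : B ⟶ A
  t : A ⟶ J

/-- A morphism from the polynomial `I ⟵ D ⟶ C' ⟶ J` to the polynomial `I ⟵ B ⟶ A ⟶ J`: a
commutative diagram
```
I ⟵ D ⟶ C' ⟶ J
‖    ↑w   ‖    ‖
‖    E ⟶ C'   ‖
‖    ↓β   ↓α   ‖
I ⟵ B ⟶ A  ⟶ J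
```
whose lower middle square is a pullback; `p` is the middle horizontal map. -/
structure PolyMor {I J : C} (G F : Poly I J) where
  E : C
  p : E ⟶ G.A
  w : E ⟶ G.B
  β : E ⟶ F.B
  α : G.A ⟶ F.A
  w_f : w ≫ G.f = p
  w_s : w ≫ G.s = β ≫ F.s
  isPullback : IsPullback β p F.f α
  α_t : α ≫ F.t = G.t

/-- The middle row `I ⟵ E ⟶ C' ⟶ J` of a morphism of polynomials. -/
abbrev PolyMor.mid {I J : C} {G F : Poly I J} (d : PolyMor G F) : Poly I J where
  B := d.E
  A := G.A
  s := d.w ≫ G.s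
  f := d.p
  t := G.t

/-- `e` is an isomorphism between two morphisms `G ⟶ F` of polynomials: an isomorphism between the
middle objects which is compatible with all the arrows of the two diagrams, all the other objects
being fixed. -/
structure PolyMor.IsIsoOfDiagrams {I J : C} {G F : Poly I J} (d d' : PolyMor G F) (e : d.E ≅ d'.E) :
    Prop where
  p : e.hom ≫ d'.p = d.p
  w : e.hom ≫ d'.w = d.w
  β : e.hom ≫ d'.β = d.β
  α : d.α = d'.α

variable [ChosenPullbacks C] [LocallyCartesianClosed C]

/-- The extension `t_! f_* s^*` of a polynomial. -/
abbrev Poly.ext {I J : C} (F : Poly I J) : Over I ⥤ Over J := pb F.s ⋙ push F.f ⋙ Over.map F.t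

/-- The canonical strength of the extension of a polynomial. -/
def Poly.strength [CartesianMonoidalCategory C] {I J : C} (F : Poly I J) : Strength F.ext :=
  (strengthPullback F.s).comp ((strengthPush F.f).comp (strengthMap F.t))

/-- The natural transformation `t_! f'_* s'^* ⟶ t_! f_* s^*` induced by `w : B ⟶ B'` over `I` and
over `A`. It is `t_!` applied to the composite
`f'_* s'^* ⟶ f'_* w_* w^* s'^* ≅ f'_* w_* s^* ≅ f_* s^*` beginning with the unit of `w^* ⊣ w_*`. -/
def vertTrans {I J A B B' : C} {s' : B' ⟶ I} {f' : B' ⟶ A} {s : B ⟶ I} {f : B ⟶ A} (t : A ⟶ J)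
    (w : B ⟶ B') (hs : w ≫ s' = s) (hf : w ≫ f' = f) :
    (Poly.mk B' A s' f' t).ext ⟶ (Poly.mk B A s f t).ext where
  app X := (Over.map t).map
    ((push f').map ((pushAdj w).unit.app ((pb s').obj X)) ≫
      (push f').map ((push w).map ((pbTriangle hs).hom.app X)) ≫
        (pushTriangle hf).hom.app ((pb s).obj X))
  naturality X Y g := by
    have h₁ : (pb s').map g ≫ (pushAdj w).unit.app ((pb s').obj Y) =
      (pushAdj w).unit.app ((pb s').obj X) ≫ (push w).map ((pb w).map ((pb s').map g)) :=
      (pushAdj w).unit.naturality _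
    have h₂ : (pb w).map ((pb s').map g) ≫ (pbTriangle hs).hom.app Y =
      (pbTriangle hs).hom.app X ≫ (pb s).map g := (pbTriangle hs).hom.naturality g
    have h₃ : (push f').map ((push w).map ((pb s).map g)) ≫
        (pushTriangle hf).hom.app ((pb s).obj Y) =
      (pushTriangle hf).hom.app ((pb s).obj X) ≫ (push f).map ((pb s).map g) :=
      (pushTriangle hf).hom.naturality _
    dsimp only [Functor.comp_map, Functor.comp_obj]
    rw [← Functor.map_comp, ← Functor.map_comp]
    congr 1
    simp only [Category.assoc]
    rw [← h₃, ← Functor.map_comp_assoc, h₁, Functor.map_comp_assoc]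
    congr 1
    rw [← Functor.map_comp_assoc, ← Functor.map_comp, h₂, Functor.map_comp, Functor.map_comp,
      Category.assoc]

/-- The natural transformation `t'_! α^* ⟶ t_!` for `α ≫ t = t'`, given by the counit
`α_! α^* ⟶ 𝟭`. -/
def sumCounit {J A A' : C} {α : A' ⟶ A} {t : A ⟶ J} {t' : A' ⟶ J} (h₀ : α ≫ t = t') :
    pb α ⋙ Over.map t' ⟶ Over.map t where
  app Z := Over.homMk ((ChosenPullbacksAlong.mapPullbackAdj α).counit.app Z).left (by
    have h := pb_condition α Z
    have h' : pbFst α Z ≫ Z.hom ≫ t = ((pb α).obj Z).hom ≫ t' := by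
      rw [reassoc_of% h, h₀]
    exact h')
  naturality X Y g := by
    apply Over.OverMorphism.ext
    exact pb_map_fst α g

/-- The natural transformation `t'_! f'_* s'^* ⟶ t_! f_* s^*` induced by a diagram
```
I ⟵ B' ⟶ A' ⟶ J
‖    ↓β    ↓α   ‖
I ⟵ B ⟶  A  ⟶ J
```
whose middle square is a pullback. It is the composite
`t'_! f'_* s'^* ≅ t'_! f'_* β^* s^* ≅ t'_! α^* f_* s^* ⟶ t_! f_* s^*`. -/
noncomputable def cartTrans {I J : C} (F' F : Poly I J) (β : F'.B ⟶ F.B) (α : F'.A ⟶ F.A)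
    (hs : β ≫ F.s = F'.s) (sq : IsPullback β F'.f F.f α) (ht : α ≫ F.t = F'.t) :
    F'.ext ⟶ F.ext where
  app X :=
    (Over.map F'.t).map ((push F'.f).map ((pbTriangle hs).inv.app X)) ≫
      (Over.map F'.t).map ((beckChevalley sq).inv.app ((pb F.s).obj X)) ≫
        (sumCounit ht).app ((push F.f).obj ((pb F.s).obj X))
  naturality X Y g := by
    have h₁ : (pb F'.s).map g ≫ (pbTriangle hs).inv.app Y =
      (pbTriangle hs).inv.app X ≫ (pb β).map ((pb F.s).map g) := (pbTriangle hs).inv.naturality g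
    have h₂ : (push F'.f).map ((pb β).map ((pb F.s).map g)) ≫
        (beckChevalley sq).inv.app ((pb F.s).obj Y) =
      (beckChevalley sq).inv.app ((pb F.s).obj X) ≫ (pb α).map ((push F.f).map ((pb F.s).map g)) :=
      (beckChevalley sq).inv.naturality _
    have h₃ : (Over.map F'.t).map ((pb α).map ((push F.f).map ((pb F.s).map g))) ≫
        (sumCounit ht).app ((push F.f).obj ((pb F.s).obj Y)) =
      (sumCounit ht).app ((push F.f).obj ((pb F.s).obj X)) ≫
        (Over.map F.t).map ((push F.f).map ((pb F.s).map g)) := (sumCounit ht).naturality _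
    dsimp only [Functor.comp_map, Functor.comp_obj]
    simp only [Category.assoc]
    rw [← h₃, ← Functor.map_comp_assoc, ← Functor.map_comp, h₁, Functor.map_comp,
      Functor.map_comp_assoc]
    congr 1
    rw [← Functor.map_comp_assoc, h₂, Functor.map_comp_assoc]

/-- The vertical part `G.ext ⟶ d.mid.ext` of the transformation induced by a morphism `d`. -/
def PolyMor.vert {I J : C} {G F : Poly I J} (d : PolyMor G F) : G.ext ⟶ d.mid.ext :=
  vertTrans G.t d.w rfl d.w_f

/-- The cartesian part `d.mid.ext ⟶ F.ext` of the transformation induced by a morphism `d`; the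
transformation represented by `d` is `d.vert ≫ d.cart : G.ext ⟶ F.ext`. -/
noncomputable def PolyMor.cart {I J : C} {G F : Poly I J} (d : PolyMor G F) : d.mid.ext ⟶ F.ext :=
  cartTrans d.mid F d.β d.α d.w_s.symm d.isPullback d.α_t

/-- The morphism over `F.A` from an object to `f_* s^* 1`. -/
def Poly.toOne {I J : C} (F : Poly I J) (Z : Over F.A) :
    Z ⟶ (push F.f).obj ((pb F.s).obj (Over.mk (𝟙 I))) :=
  (pushAdj F.f).homEquiv _ _ (Over.homMk
    (pbLift F.s (Over.mk (𝟙 I)) (((pb F.f).obj Z).hom ≫ F.s) ((pb F.f).obj Z).hom (by simp))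
    (by simp))

lemma Poly.toOne_unique {I J : C} (F : Poly I J) {Z : Over F.A}
    (a b : Z ⟶ (push F.f).obj ((pb F.s).obj (Over.mk (𝟙 I)))) : a = b := by
  apply push_ext
  apply Over.OverMorphism.ext
  have key : ∀ c d : (pb F.f).obj Z ⟶ (pb F.s).obj (Over.mk (𝟙 I)), c.left = d.left := by
    intro c d
    apply pb_ext
    · have h := pb_condition F.s (Over.mk (𝟙 I))
      simp only [Over.mk_hom] at h
      have h' : pbFst F.s (Over.mk (𝟙 I)) = ((pb F.s).obj (Over.mk (𝟙 I))).hom ≫ F.s := by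
        rw [← h]; exact (Category.comp_id _).symm
      rw [h', Over.w_assoc, Over.w_assoc]
    · rw [Over.w, Over.w]
  exact key _ _

/-- The canonical isomorphism between the value of `F.ext` at the terminal object of the slice over
`I` and the object `A ⟶ J`; its underlying map is the structure map of `f_* s^* 1` over `A`. -/
def Poly.extOneIso {I J : C} (F : Poly I J) : F.ext.obj (Over.mk (𝟙 I)) ≅ Over.mk F.t where
  hom := Over.homMk ((push F.f).obj ((pb F.s).obj (Over.mk (𝟙 I)))).hom
  inv := Over.homMk (F.toOne (Over.mk (𝟙 F.A))).left (by
    have h := Over.w (F.toOne (Over.mk (𝟙 F.A)))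
    simp only [Over.mk_hom] at h
    simp only [Functor.comp_obj, Over.map_obj_hom, Over.mk_hom]
    rw [reassoc_of% h]
    exact Category.id_comp _)
  hom_inv_id := by
    apply Over.OverMorphism.ext
    have h := congrArg (fun k => Over.Hom.left k) (F.toOne_unique
      (Over.homMk ((push F.f).obj ((pb F.s).obj (Over.mk (𝟙 I)))).hom ≫
        F.toOne (Over.mk (𝟙 F.A))) (𝟙 _))
    exact h
  inv_hom_id := by
    apply Over.OverMorphism.ext
    exact Over.w (F.toOne (Over.mk (𝟙 F.A)))

/-- A transformation between extensions of polynomials with the same `A ⟶ J` is vertical if its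
component at the terminal object is the identity of `A`, under the canonical identifications. -/
def IsVertical {I J A B B' : C} {s' : B' ⟶ I} {f' : B' ⟶ A} {s : B ⟶ I} {f : B ⟶ A} {t : A ⟶ J}
    (φ : (Poly.mk B' A s' f' t).ext ⟶ (Poly.mk B A s f t).ext) : Prop :=
  (Poly.mk B' A s' f' t).extOneIso.inv ≫ φ.app (Over.mk (𝟙 I)) ≫
    (Poly.mk B A s f t).extOneIso.hom = 𝟙 (Over.mk t)

end Polynomials

end PolyFun

namespace PolyFun

open MonoidalCategory CartesianMonoidalCategory

universe v u

/-! ### Chosen pullbacks in terms of generalized elements. -/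

section PullbackLemmas

variable {C : Type u} [Category.{v} C] [ChosenPullbacks C]

/-! Everything is done with generalized elements. A map from `Z` to the total object of `F.ext.obj
X` is a base `a : Z ⟶ F.A` together with a section, that is, a map over `I` from the fibre `Z ×_A B`
to `X`. `Poly.base` reads off the base and `Poly.ev` the values of the section; `Poly.hom_ext` and
`Poly.exists_hom` say that these data determine the element and may be prescribed. In these terms
the vertical part precomposes sections with `w` (`ev_vert`), the cartesian part applies `α` to the
base and keeps the section, since fibres of `p` are fibres of `f` (`ev_cart`), and the strength
adjoins a constant coordinate (`ev_strength`). The first half of the theorem follows from these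
formulas.

For the second half, `G.generic` is the element of the extension at `G.s` with identity base and
identity section. For strong `φ` the data are forced: `α` is the base of `φ` at the generic element,
`E` is the pullback of `f` and `α`, and `w` is the section of `φ` at the generic element. The core
is `ev_app_of_isStrong`, a Yoneda lemma for strong transformations: naturality alone does not reduce
an element over `Z` to the generic one, but its fibre `R` embeds in `Z × D`, and there the strength
expresses the tautological element through `G.generic`. Evaluating the represented transformation at
the generic element recovers `α` and `w`, which gives uniqueness. -/

lemma comp_pbLift {B A : C} (f : B ⟶ A) (X : Over A) {Z W : C} (k : W ⟶ Z) (a : Z ⟶ X.left)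
    (b : Z ⟶ B) (h : a ≫ X.hom = b ≫ f) :
    k ≫ pbLift f X a b h = pbLift f X (k ≫ a) (k ≫ b) (by simp [h]) := by
  apply pb_ext <;> simp

lemma pbLift_comp_map {B A : C} (f : B ⟶ A) {X Y : Over A} (g : X ⟶ Y) {Z : C} (a : Z ⟶ X.left)
    (b : Z ⟶ B) (h : a ≫ X.hom = b ≫ f) (h' : (a ≫ g.left) ≫ Y.hom = b ≫ f) :
    pbLift f X a b h ≫ ((pb f).map g).left = pbLift f Y (a ≫ g.left) b h' := by
  apply pb_ext <;> simp

lemma pb_isPullback {B A : C} (f : B ⟶ A) (X : Over A) :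
    IsPullback ((pb f).obj X).hom (pbFst f X) f X.hom :=
  IsPullback.of_isLimit' ⟨(pb_condition f X).symm⟩ <|
    Limits.PullbackCone.IsLimit.mk _
      (fun c => pbLift f X c.snd c.fst c.condition.symm)
      (fun c => by simp) (fun c => by simp)
      (fun c m h₁ h₂ => pb_ext f X (by simpa using h₂) (by simpa using h₁))

end PullbackLemmas

/-! ### Generalized elements of dependent products and their evaluation. -/

section PushEval

variable {C : Type u} [Category.{v} C] [ChosenPullbacks C] [LocallyCartesianClosed C]

/-- Evaluation of a generalized element `y` of `f_* Y` at a generalized element `b` of the fibre of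
`f` over the image of `y`. -/
def pushEval {B A : C} (f : B ⟶ A) (Y : Over B) {P : C} (y : P ⟶ ((push f).obj Y).left)
    (b : P ⟶ B) (h : y ≫ ((push f).obj Y).hom = b ≫ f) : P ⟶ Y.left :=
  pbLift f _ y b h ≫ ((pushAdj f).counit.app Y).left

lemma pushEval_hom {B A : C} (f : B ⟶ A) (Y : Over B) {P : C} (y : P ⟶ ((push f).obj Y).left)
    (b : P ⟶ B) (h : y ≫ ((push f).obj Y).hom = b ≫ f) : pushEval f Y y b h ≫ Y.hom = b := by
  have := Over.w ((pushAdj f).counit.app Y)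
  dsimp at this
  simp [pushEval, this]

lemma comp_pushEval {B A : C} (f : B ⟶ A) (Y : Over B) {P Q : C} (k : Q ⟶ P)
    (y : P ⟶ ((push f).obj Y).left) (b : P ⟶ B) (h : y ≫ ((push f).obj Y).hom = b ≫ f) :
    k ≫ pushEval f Y y b h = pushEval f Y (k ≫ y) (k ≫ b) (by simp [h]) := by
  rw [pushEval, pushEval, ← comp_pbLift, Category.assoc]

lemma pushEval_comp_left {B A : C} (f : B ⟶ A) {X : Over A} {Y : Over B}
    (a : X ⟶ (push f).obj Y) (c : (pb f).obj X ⟶ Y)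
    (hc : (pb f).map a ≫ (pushAdj f).counit.app Y = c) {P : C} (y : P ⟶ X.left) (b : P ⟶ B)
    (h : y ≫ X.hom = b ≫ f) (h' : (y ≫ a.left) ≫ ((push f).obj Y).hom = b ≫ f) :
    pushEval f Y (y ≫ a.left) b h' = pbLift f X y b h ≫ c.left := by
  subst hc
  rw [pushEval, ← pbLift_comp_map f a y b h h']
  simp

lemma pushEval_map {B A : C} (f : B ⟶ A) {Y Y' : Over B} (g : Y ⟶ Y') {P : C}
    (y : P ⟶ ((push f).obj Y).left) (b : P ⟶ B) (h : y ≫ ((push f).obj Y).hom = b ≫ f)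
    (h' : (y ≫ ((push f).map g).left) ≫ ((push f).obj Y').hom = b ≫ f) :
    pushEval f Y' (y ≫ ((push f).map g).left) b h' = pushEval f Y y b h ≫ g.left := by
  rw [pushEval_comp_left f _ _ ((pushAdj f).counit.naturality g) y b h h']
  simp [pushEval]

/-- Generalized elements of `f_* Y` over `a` correspond to their evaluations. -/
lemma push_hom_ext {B A : C} (f : B ⟶ A) (Y : Over B) {Z P : C} {z z' : Z ⟶ ((push f).obj Y).left}
    {b : P ⟶ B} {q : P ⟶ Z} (sq : IsPullback b q f (z ≫ ((push f).obj Y).hom))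
    (h : z ≫ ((push f).obj Y).hom = z' ≫ ((push f).obj Y).hom)
    (he : pushEval f Y (q ≫ z) b (by simp [sq.w]) =
      pushEval f Y (q ≫ z') b (by simp [sq.w, h])) : z = z' := by
  let X : Over A := Over.mk (z ≫ ((push f).obj Y).hom)
  let a : X ⟶ (push f).obj Y := Over.homMk z rfl
  let a' : X ⟶ (push f).obj Y := Over.homMk z' h.symm
  suffices a = a' from congrArg (fun k => Over.Hom.left k) this
  apply push_ext
  apply Over.OverMorphism.ext
  have hq : q ≫ X.hom = b ≫ f := sq.w.symm
  have e := pushEval_comp_left f a _ rfl q b hq (by simp [a, sq.w])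
  have e' := pushEval_comp_left f a' _ rfl q b hq (by simp [a', sq.w, h])
  -- The comparison from the given pullback to the chosen one is split epi, so agreement of the
  -- values on `P` gives agreement of the transposes.
  have hiso : ∃ k, k ≫ pbLift f X q b hq = 𝟙 _ := by
    refine ⟨sq.lift ((pb f).obj X).hom (pbFst f X) (pb_condition f X).symm, ?_⟩
    apply pb_ext <;> simp
  obtain ⟨k, hk⟩ := hiso
  rw [← Category.id_comp ((pb f).map a ≫ (pushAdj f).counit.app Y).left,
    ← Category.id_comp ((pb f).map a' ≫ (pushAdj f).counit.app Y).left, ← hk, Category.assoc,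
    Category.assoc, ← e, ← e']
  exact congrArg (k ≫ ·) he

/-- The element is the transpose of `m`, moved to the chosen pullback. This is the existence
counterpart of `push_hom_ext`. -/
lemma push_hom_exists {B A : C} (f : B ⟶ A) (Y : Over B) {Z P : C} (a : Z ⟶ A)
    {b : P ⟶ B} {q : P ⟶ Z} (sq : IsPullback b q f a) (m : P ⟶ Y.left) (hm : m ≫ Y.hom = b) :
    ∃ (z : Z ⟶ ((push f).obj Y).left) (hz : z ≫ ((push f).obj Y).hom = a),
      pushEval f Y (q ≫ z) b (by simp [sq.w, hz]) = m := by
  let X : Over A := Over.mk a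
  let n : ((pb f).obj X) ⟶ Y :=
    Over.homMk (sq.lift ((pb f).obj X).hom (pbFst f X) (pb_condition f X).symm ≫ m) (by simp [hm])
  let z : X ⟶ (push f).obj Y := (pushAdj f).homEquiv _ _ n
  have hn : (pb f).map z ≫ (pushAdj f).counit.app Y = n :=
    ((pushAdj f).homEquiv_counit _ _ z).symm.trans (Equiv.symm_apply_apply _ n)
  have hq : q ≫ X.hom = b ≫ f := sq.w.symm
  refine ⟨z.left, Over.w z, ?_⟩
  rw [pushEval_comp_left f z n hn q b hq]
  have : pbLift f X q b hq ≫ sq.lift ((pb f).obj X).hom (pbFst f X) (pb_condition f X).symm =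
      𝟙 _ := by
    apply sq.hom_ext <;> simp
  simp only [n, Over.homMk_left, reassoc_of% this]

/-- The counit of a composite adjunction is an iterated counit, so a value at `b` is obtained by
evaluating first at the image of `b` under `w` and then at `b`. -/
lemma pushEval_pushTriangle {B B' A : C} {w : B ⟶ B'} {f' : B' ⟶ A} {f : B ⟶ A} (hf : w ≫ f' = f)
    (Y : Over B) {P : C} (y : P ⟶ ((push f').obj ((push w).obj Y)).left) (b : P ⟶ B)
    (h : y ≫ ((push f').obj ((push w).obj Y)).hom = (b ≫ w) ≫ f')
    (h' : (y ≫ ((pushTriangle hf).hom.app Y).left) ≫ ((push f).obj Y).hom = b ≫ f) :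
    pushEval f Y (y ≫ ((pushTriangle hf).hom.app Y).left) b h' =
      pushEval w Y (pushEval f' _ y (b ≫ w) h) b (pushEval_hom _ _ _ _ _) := by
  have e := conjugateEquiv_counit ((pushAdj f').comp (pushAdj w)) (pushAdj f)
    (pbTriangle hf).symm.hom Y
  rw [Adjunction.comp_counit_app] at e
  have e' : (pb f).map ((pushTriangle hf).hom.app Y) ≫ (pushAdj f).counit.app Y =
    (pbTriangle hf).inv.app ((push f').obj ((push w).obj Y)) ≫
      (pb w).map ((pushAdj f').counit.app ((push w).obj Y)) ≫ (pushAdj w).counit.app Y := e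
  rw [pushEval_comp_left f _ _ e' y b (by simp [h, hf]), Over.comp_left, Over.comp_left]
  refine (Category.assoc _ _ _).symm.trans ((Category.assoc _ _ _).symm.trans ?_)
  refine congrArg (· ≫ ((pushAdj w).counit.app Y).left) ?_
  have hm : ((pb w).map ((pushAdj f').counit.app ((push w).obj Y))).left ≫
      pbFst w ((push w).obj Y) =
    pbFst w _ ≫ ((pushAdj f').counit.app ((push w).obj Y)).left := pb_map_fst w _
  apply pb_ext w ((push w).obj Y)
  · rw [pbLift_fst, Category.assoc, Category.assoc, hm, pushEval]
    simp only [← Category.assoc]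
    congr 1
    apply pb_ext <;> simp [pbTriangle]
  · simp [pbTriangle]

lemma pushEval_unit_comp_map {B A : C} (f : B ⟶ A) {X : Over A} {Y : Over B}
    (k : (pb f).obj X ⟶ Y) {P : C} (y : P ⟶ X.left) (b : P ⟶ B) (h : y ≫ X.hom = b ≫ f)
    (h' : (y ≫ ((pushAdj f).unit.app X ≫ (push f).map k).left) ≫ ((push f).obj Y).hom = b ≫ f) :
    pushEval f Y (y ≫ ((pushAdj f).unit.app X ≫ (push f).map k).left) b h' =
      pbLift f X y b h ≫ k.left :=
  pushEval_comp_left f ((pushAdj f).unit.app X ≫ (push f).map k) k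
    (((pushAdj f).homEquiv_counit _ _ _).symm.trans
      (((pushAdj f).homEquiv _ _).symm_apply_eq.2 ((pushAdj f).homEquiv_unit _ _ k).symm)) y b h h'

lemma pushEval_map_pushTriangle {B B' A : C} {w : B ⟶ B'} {f' : B' ⟶ A} {f : B ⟶ A}
    (hf : w ≫ f' = f) {X : Over B'} {Y : Over B} (k : (pb w).obj X ⟶ Y) {P : C}
    (y : P ⟶ ((push f').obj X).left) (b : P ⟶ B) (h : y ≫ ((push f').obj X).hom = (b ≫ w) ≫ f')
    (h' : ((y ≫ ((push f').map ((pushAdj w).unit.app X ≫ (push w).map k)).left) ≫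
      ((pushTriangle hf).hom.app Y).left) ≫ ((push f).obj Y).hom = b ≫ f) :
    pushEval f Y ((y ≫ ((push f').map ((pushAdj w).unit.app X ≫ (push w).map k)).left) ≫
      ((pushTriangle hf).hom.app Y).left) b h' =
      pbLift w X (pushEval f' X y (b ≫ w) h) b (pushEval_hom _ _ _ _ _) ≫ k.left := by
  have h₁ : (y ≫ ((push f').map ((pushAdj w).unit.app X ≫ (push w).map k)).left) ≫
      ((push f').obj ((push w).obj Y)).hom = (b ≫ w) ≫ f' := by
    rw [Category.assoc]
    exact (congrArg (y ≫ ·) (Over.w _)).trans h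
  rw [pushEval_pushTriangle hf Y _ b h₁ h', ← pushEval_unit_comp_map]
  · congr 1
    exact pushEval_map f' _ y (b ≫ w) h h₁
  · rw [Category.assoc]
    exact (congrArg (_ ≫ ·) (Over.w _)).trans (pushEval_hom _ _ _ _ _)

/-- Compatibility of conjugate transformations with counits shows that the Beck–Chevalley map keeps
the values of a section: `β` identifies each fibre of `p` with a fibre of `f`. -/
lemma pushEval_beckChevalley_hom {E A' B A : C} {β : E ⟶ B} {p : E ⟶ A'} {f : B ⟶ A} {α : A' ⟶ A}
    (sq : IsPullback β p f α) (Y : Over B) {P : C} (y : P ⟶ ((pb α).obj ((push f).obj Y)).left)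
    (e : P ⟶ E) (h₀ : y ≫ ((pb α).obj ((push f).obj Y)).hom = e ≫ p)
    (h : (y ≫ ((beckChevalley sq).hom.app Y).left) ≫ ((push p).obj ((pb β).obj Y)).hom = e ≫ p)
    (h' : (y ≫ pbFst α ((push f).obj Y)) ≫ ((push f).obj Y).hom = (e ≫ β) ≫ f) :
    pushEval p _ (y ≫ ((beckChevalley sq).hom.app Y).left) e h ≫ pbFst β Y =
      pushEval f Y (y ≫ pbFst α ((push f).obj Y)) (e ≫ β) h' := by
  have e₁ := conjugateEquiv_counit ((ChosenPullbacksAlong.mapPullbackAdj α).comp (pushAdj f))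
    ((pushAdj p).comp (ChosenPullbacksAlong.mapPullbackAdj β)) (leftBeckChevalley sq).hom Y
  rw [Adjunction.comp_counit_app, Adjunction.comp_counit_app] at e₁
  have e₂ := congrArg (fun k => Over.Hom.left k) e₁
  have e₃ : ((pb p).map ((beckChevalley sq).hom.app Y)).left ≫
      ((pushAdj p).counit.app ((pb β).obj Y)).left ≫ pbFst β Y =
      ((leftBeckChevalley sq).hom.app ((pb α).obj ((push f).obj Y))).left ≫
      ((pb f).map ((ChosenPullbacksAlong.mapPullbackAdj α).counit.app ((push f).obj Y))).left ≫
      ((pushAdj f).counit.app Y).left := e₂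
  refine (congrArg (· ≫ pbFst β Y)
    (pushEval_comp_left p ((beckChevalley sq).hom.app Y) _ rfl y e h₀ h)).trans ?_
  rw [Over.comp_left, Category.assoc, Category.assoc, e₃, pushEval]
  simp only [← Category.assoc]
  congr 1
  apply pb_ext
  · rw [Category.assoc, pb_map_fst]
    have : ((ChosenPullbacksAlong.mapPullbackAdj α).counit.app ((push f).obj Y)).left =
      pbFst α _ := rfl
    simp [this, leftBeckChevalley]
  · simp [leftBeckChevalley]

lemma pushEval_beckChevalley_inv {E A' B A : C} {β : E ⟶ B} {p : E ⟶ A'} {f : B ⟶ A} {α : A' ⟶ A}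
    (sq : IsPullback β p f α) (Y : Over B) {P : C} (y : P ⟶ ((push p).obj ((pb β).obj Y)).left)
    (e : P ⟶ E) (h : y ≫ ((push p).obj ((pb β).obj Y)).hom = e ≫ p)
    (h' : ((y ≫ ((beckChevalley sq).inv.app Y).left) ≫ pbFst α ((push f).obj Y)) ≫
      ((push f).obj Y).hom = (e ≫ β) ≫ f) :
    pushEval f Y ((y ≫ ((beckChevalley sq).inv.app Y).left) ≫ pbFst α ((push f).obj Y)) (e ≫ β) h' =
      pushEval p _ y e h ≫ pbFst β Y := by
  have hy : (y ≫ ((beckChevalley sq).inv.app Y).left) ≫ ((beckChevalley sq).hom.app Y).left =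
      y := by
    rw [Category.assoc, ← Over.comp_left, Iso.inv_hom_id_app]
    exact Category.comp_id y
  have h₀ : (y ≫ ((beckChevalley sq).inv.app Y).left) ≫ ((pb α).obj ((push f).obj Y)).hom =
      e ≫ p := by
    rw [Category.assoc]
    exact (congrArg (y ≫ ·) (Over.w ((beckChevalley sq).inv.app Y))).trans h
  rw [← pushEval_beckChevalley_hom sq Y _ e h₀ (by rw [hy, h]) h']
  simp only [hy]

end PushEval

section

variable {C : Type u} [Category.{v} C] [CartesianMonoidalCategory C] [ChosenPullbacks C]
  [LocallyCartesianClosed C]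

lemma pushEval_pushStrengthApp {B A : C} (f : B ⟶ A) (K : C) (Y : Over B) {P : C}
    (y : P ⟶ K ⊗ ((push f).obj Y).left) (b : P ⟶ B)
    (h : (y ≫ snd _ _) ≫ ((push f).obj Y).hom = b ≫ f)
    (h' : (y ≫ (pushStrengthApp f K Y).left) ≫ ((push f).obj (tens K Y)).hom = b ≫ f) :
    pushEval f (tens K Y) (y ≫ (pushStrengthApp f K Y).left) b h' =
      lift (y ≫ fst _ _) (pushEval f Y (y ≫ snd _ _) b h) := by
  rw [pushEval_comp_left f _ _ (pushStrengthApp_counit f K Y) y b (by simpa using h)]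
  apply CartesianMonoidalCategory.hom_ext
  · simp [pbTens]
  · simp only [Over.comp_left, pbTens, Over.homMk_left, Category.assoc, tensorHom_snd, lift_snd,
      pushEval, lift_snd_assoc]
    simp only [← Category.assoc]
    congr 1
    apply pb_ext <;> simp

end

/-! ### Elements of a polynomial functor as a base with a section over its fibre. -/

namespace Poly

variable {C : Type u} [Category.{v} C] [ChosenPullbacks C] [LocallyCartesianClosed C] {I J : C}

/-- The structure map over `A` of the extension of a polynomial. -/
def base (F : Poly I J) (X : Over I) : (F.ext.obj X).left ⟶ F.A :=
  ((push F.f).obj ((pb F.s).obj X)).hom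

/-- A generalized element `y` of the extension of `F` at `X` is a section of `X` over a fibre of
`F.f`; this is its value at the generalized element `b` of that fibre. -/
def ev (F : Poly I J) (X : Over I) {P : C} (y : P ⟶ (F.ext.obj X).left) (b : P ⟶ F.B)
    (h : y ≫ F.base X = b ≫ F.f) : P ⟶ X.left :=
  pushEval F.f ((pb F.s).obj X) y b h ≫ pbFst F.s X

variable (F : Poly I J)

lemma base_t (X : Over I) : F.base X ≫ F.t = (F.ext.obj X).hom := rfl

variable {F}

lemma ev_congr {X : Over I} {P : C} {y y' : P ⟶ (F.ext.obj X).left} {b b' : P ⟶ F.B}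
    {h : y ≫ F.base X = b ≫ F.f} (hy : y = y') (hb : b = b') :
    F.ev X y b h = F.ev X y' b' (by rw [← hy, ← hb, h]) := by
  subst hy hb
  rfl

lemma ev_hom {X : Over I} {P : C} (y : P ⟶ (F.ext.obj X).left) (b : P ⟶ F.B)
    (h : y ≫ F.base X = b ≫ F.f) : F.ev X y b h ≫ X.hom = b ≫ F.s := by
  rw [ev, Category.assoc, pb_condition, ← Category.assoc]
  exact congrArg (· ≫ F.s) (pushEval_hom F.f _ y b h)

lemma comp_ev {X : Over I} {P Q : C} (k : Q ⟶ P) (y : P ⟶ (F.ext.obj X).left) (b : P ⟶ F.B)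
    (h : y ≫ F.base X = b ≫ F.f) :
    k ≫ F.ev X y b h = F.ev X (k ≫ y) (k ≫ b) (by simp [h]) := by
  rw [ev, ← Category.assoc]
  exact congrArg (· ≫ pbFst F.s X) (comp_pushEval F.f _ k y b h)

lemma map_base {X Y : Over I} (g : X ⟶ Y) : (F.ext.map g).left ≫ F.base Y = F.base X :=
  Over.w ((push F.f).map ((pb F.s).map g))

lemma ev_map {X Y : Over I} (g : X ⟶ Y) {P : C} (y : P ⟶ (F.ext.obj X).left) (b : P ⟶ F.B)
    (h : y ≫ F.base X = b ≫ F.f) (h' : (y ≫ (F.ext.map g).left) ≫ F.base Y = b ≫ F.f) :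
    F.ev Y (y ≫ (F.ext.map g).left) b h' = F.ev X y b h ≫ g.left := by
  have := pushEval_map F.f ((pb F.s).map g) y b h h'
  refine (congrArg (· ≫ pbFst F.s Y) this).trans ?_
  rw [ev, Category.assoc, Category.assoc, pb_map_fst]

/-- One test point suffices, namely the universal point of the fibre; any pullback may serve as that
fibre. -/
lemma hom_ext_of_isPullback {X : Over I} {Z P : C} {z z' : Z ⟶ (F.ext.obj X).left} {b : P ⟶ F.B}
    {q : P ⟶ Z} (sq : IsPullback b q F.f (z ≫ F.base X)) (h : z ≫ F.base X = z' ≫ F.base X)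
    (he : F.ev X (q ≫ z) b (by simp [sq.w]) = F.ev X (q ≫ z') b (by simp [sq.w, h])) :
    z = z' := by
  refine push_hom_ext F.f ((pb F.s).obj X) sq h ?_
  apply pb_ext
  · exact he
  · rw [pushEval_hom, pushEval_hom]

lemma hom_ext {X : Over I} {Z : C} {z z' : Z ⟶ (F.ext.obj X).left}
    (h : z ≫ F.base X = z' ≫ F.base X)
    (he : ∀ (P : C) (b : P ⟶ F.B) (q : P ⟶ Z) (hq : (q ≫ z) ≫ F.base X = b ≫ F.f)
      (hq' : (q ≫ z') ≫ F.base X = b ≫ F.f), F.ev X (q ≫ z) b hq = F.ev X (q ≫ z') b hq') :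
    z = z' :=
  hom_ext_of_isPullback (pb_isPullback F.f (Over.mk (z ≫ F.base X))) h (he _ _ _ _ _)

lemma exists_hom {X : Over I} {Z P : C} (a : Z ⟶ F.A) {b : P ⟶ F.B} {q : P ⟶ Z}
    (sq : IsPullback b q F.f a) (m : P ⟶ X.left) (hm : m ≫ X.hom = b ≫ F.s) :
    ∃ (z : Z ⟶ (F.ext.obj X).left) (hz : z ≫ F.base X = a),
      F.ev X (q ≫ z) b (by simp [sq.w, hz]) = m := by
  obtain ⟨z, hz, h⟩ := push_hom_exists F.f ((pb F.s).obj X) a sq (pbLift F.s X m b hm) (by simp)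
  refine ⟨z, hz, ?_⟩
  refine (congrArg (· ≫ pbFst F.s X) h).trans ?_
  simp

end Poly

/-! ### The vertical and cartesian parts in terms of base and section. -/

section Transformations

variable {C : Type u} [Category.{v} C] [ChosenPullbacks C] [LocallyCartesianClosed C] {I J : C}
  {G F : Poly I J} (d : PolyMor G F)

namespace PolyMor

lemma vert_base (X : Over I) : (d.vert.app X).left ≫ d.mid.base X = G.base X :=
  Over.w ((push G.f).map ((pushAdj d.w).unit.app ((pb G.s).obj X)) ≫
      (push G.f).map ((push d.w).map ((pbTriangle (rfl : d.w ≫ G.s = d.w ≫ G.s)).hom.app X)) ≫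
        (pushTriangle d.w_f).hom.app ((pb (d.w ≫ G.s)).obj X))

lemma ev_vert {X : Over I} {P : C} (y : P ⟶ (G.ext.obj X).left) (e : P ⟶ d.E)
    (h : y ≫ G.base X = (e ≫ d.w) ≫ G.f)
    (h' : (y ≫ (d.vert.app X).left) ≫ d.mid.base X = e ≫ d.p) :
    d.mid.ev X (y ≫ (d.vert.app X).left) e h' = G.ev X y (e ≫ d.w) h := by
  -- The unit followed by `push d.w` of the triangle isomorphism is the transpose of that
  -- isomorphism, which is the form evaluated by `pushEval_map_pushTriangle`.
  have hy : y ≫ (d.vert.app X).left =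
      (y ≫ ((push G.f).map ((pushAdj d.w).unit.app ((pb G.s).obj X) ≫
      (push d.w).map ((pbTriangle (rfl : d.w ≫ G.s = d.w ≫ G.s)).hom.app X))).left) ≫
        ((pushTriangle d.w_f).hom.app ((pb (d.w ≫ G.s)).obj X)).left := by
    rw [Functor.map_comp, Category.assoc, ← Over.comp_left, Category.assoc]
    rfl
  rw [Poly.ev_congr hy rfl]
  have hk : ((pbTriangle (rfl : d.w ≫ G.s = d.w ≫ G.s)).hom.app X).left ≫ pbFst (d.w ≫ G.s) X =
      pbFst d.w _ ≫ pbFst G.s X := by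
    simp [pbTriangle]
  have e₁ := pushEval_map_pushTriangle d.w_f
    ((pbTriangle (rfl : d.w ≫ G.s = d.w ≫ G.s)).hom.app X) y e h
    ((congrArg (· ≫ d.mid.base X) hy).symm.trans h')
  refine (congrArg (· ≫ pbFst (d.w ≫ G.s) X) e₁).trans ?_
  rw [Category.assoc, hk, pbLift_fst_assoc]
  rfl

lemma cart_base (X : Over I) : (d.cart.app X).left ≫ F.base X = d.mid.base X ≫ d.α := by
  let a := (push d.p).map ((pbTriangle d.w_s.symm).inv.app X)
  let b := (beckChevalley d.isPullback).inv.app ((pb F.s).obj X)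
  have h : (d.cart.app X).left = a.left ≫ b.left ≫ pbFst d.α _ := rfl
  rw [h, Category.assoc, Category.assoc]
  refine (congrArg (fun k => a.left ≫ b.left ≫ k) (pb_condition d.α _)).trans ?_
  rw [← Category.assoc b.left]
  refine (congrArg (fun k => a.left ≫ k ≫ d.α) (Over.w b)).trans ?_
  rw [← Category.assoc]
  exact congrArg (· ≫ d.α) (Over.w a)

lemma ev_cart {X : Over I} {P : C} (y : P ⟶ (d.mid.ext.obj X).left) (e : P ⟶ d.E)
    (h : y ≫ d.mid.base X = e ≫ d.p)
    (h' : (y ≫ (d.cart.app X).left) ≫ F.base X = (e ≫ d.β) ≫ F.f) :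
    F.ev X (y ≫ (d.cart.app X).left) (e ≫ d.β) h' = d.mid.ev X y e h := by
  let a := (push d.p).map ((pbTriangle d.w_s.symm).inv.app X)
  let b := (beckChevalley d.isPullback).inv.app ((pb F.s).obj X)
  have hy : y ≫ (d.cart.app X).left = ((y ≫ a.left) ≫ b.left) ≫ pbFst d.α _ := by
    simp only [Category.assoc]; rfl
  have ha : (y ≫ a.left) ≫ ((push d.p).obj ((pb d.β).obj ((pb F.s).obj X))).hom = e ≫ d.p := by
    rw [Category.assoc]
    exact (congrArg (y ≫ ·) (Over.w a)).trans h
  rw [Poly.ev_congr hy rfl]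
  have e₁ := pushEval_beckChevalley_inv d.isPullback ((pb F.s).obj X) (y ≫ a.left) e ha
    ((congrArg (· ≫ F.base X) hy).symm.trans h')
  have e₂ := pushEval_map d.p ((pbTriangle d.w_s.symm).inv.app X) y e h ha
  have hk : ((pbTriangle d.w_s.symm).inv.app X).left ≫ pbFst d.β _ ≫ pbFst F.s X =
      pbFst (d.w ≫ G.s) X := by
    simp [pbTriangle]
  refine (congrArg (· ≫ pbFst F.s X) (e₁.trans (congrArg (· ≫ pbFst d.β _) e₂))).trans ?_
  rw [Category.assoc, Category.assoc, hk]
  rfl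

end PolyMor

end Transformations

/-! ### The strength in terms of base and section. -/

section Strength

variable {C : Type u} [Category.{v} C] [CartesianMonoidalCategory C] [ChosenPullbacks C]
  [LocallyCartesianClosed C] {I J : C} {F : Poly I J}

namespace Poly

lemma strength_app_left (K : C) (X : Over I) :
    (F.strength.app K X).left = (pushStrengthApp F.f K ((pb F.s).obj X)).left ≫
      ((push F.f).map ((strengthPullback F.s).app K X)).left := by
  have : (F.strength.app K X).left = (𝟙 _ ≫ (pushStrengthApp F.f K ((pb F.s).obj X)).left) ≫
      ((push F.f).map ((strengthPullback F.s).app K X)).left := rfl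
  rw [this, Category.id_comp]

lemma strength_base (K : C) (X : Over I) :
    (F.strength.app K X).left ≫ F.base (tens K X) = snd _ _ ≫ F.base X := by
  rw [strength_app_left, Category.assoc]
  refine (congrArg (_ ≫ ·) (Over.w ((push F.f).map ((strengthPullback F.s).app K X)))).trans ?_
  exact Over.w (pushStrengthApp F.f K ((pb F.s).obj X))

/-- The strength pairs each value of a section with the fixed `K`-coordinate and leaves the base
alone. -/
lemma ev_strength {K : C} {X : Over I} {P : C} (y : P ⟶ K ⊗ (F.ext.obj X).left) (b : P ⟶ F.B)
    (h : (y ≫ snd _ _) ≫ F.base X = b ≫ F.f)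
    (h' : (y ≫ (F.strength.app K X).left) ≫ F.base (tens K X) = b ≫ F.f) :
    F.ev (tens K X) (y ≫ (F.strength.app K X).left) b h' =
      lift (y ≫ fst _ _) (F.ev X (y ≫ snd _ _) b h) := by
  have h₁ : (y ≫ (pushStrengthApp F.f K ((pb F.s).obj X)).left) ≫
      ((push F.f).obj (tens K ((pb F.s).obj X))).hom = b ≫ F.f := by
    rw [Category.assoc, Over.w (pushStrengthApp F.f K ((pb F.s).obj X)), ← h, Category.assoc]
    rfl
  have e₁ := pushEval_pushStrengthApp F.f K ((pb F.s).obj X) y b h h₁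
  have hy : y ≫ (F.strength.app K X).left = (y ≫ (pushStrengthApp F.f K ((pb F.s).obj X)).left) ≫
      ((push F.f).map ((strengthPullback F.s).app K X)).left := by
    rw [strength_app_left, Category.assoc]
  rw [ev_congr hy rfl]
  have h₂ : ((y ≫ (pushStrengthApp F.f K ((pb F.s).obj X)).left) ≫
      ((push F.f).map ((strengthPullback F.s).app K X)).left) ≫
      ((push F.f).obj ((pb F.s).obj (tens K X))).hom = b ≫ F.f := by
    rw [Category.assoc, Over.w ((push F.f).map ((strengthPullback F.s).app K X)), h₁]
  have e₂ := pushEval_map F.f ((strengthPullback F.s).app K X) _ b h₁ h₂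
  refine (congrArg (· ≫ pbFst F.s (tens K X)) (e₂.trans
    (congrArg (· ≫ ((strengthPullback F.s).app K X).left) e₁))).trans ?_
  simp only [strengthPullback, Over.homMk_left, Category.assoc, pbLift_fst]
  simp [ev]

end Poly

end Strength

lemma IsStrong.comp {C : Type u} [Category.{v} C] [CartesianMonoidalCategory C] {I J : C}
    {F G H : Over I ⥤ Over J} {σ : Strength F} {τ : Strength G} {ρ : Strength H} {φ : F ⟶ G}
    {ψ : G ⟶ H} (hφ : IsStrong σ τ φ) (hψ : IsStrong τ ρ ψ) : IsStrong σ ρ (φ ≫ ψ) := by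
  intro K X
  have h := tensMap_comp (𝟙 K) (𝟙 K) (φ.app X) (ψ.app X)
  rw [Category.comp_id] at h
  rw [NatTrans.comp_app, NatTrans.comp_app, ← h, Category.assoc, ← hψ K X, ← Category.assoc,
    hφ K X, Category.assoc]

/-! ### Strength, verticality and cartesianness of the two parts. -/

namespace PolyMor

section

variable {C : Type u} [Category.{v} C] [ChosenPullbacks C] [LocallyCartesianClosed C] {I J : C}
  {G F : Poly I J} (d : PolyMor G F)

/-- The canonical isomorphism at the terminal object is the base map, which the vertical part
preserves. -/
lemma isVertical_vert : IsVertical d.vert := by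
  apply Over.OverMorphism.ext
  exact (congrArg (_ ≫ ·) (d.vert_base (Over.mk (𝟙 I)))).trans
    (congrArg (fun k => Over.Hom.left k) G.extOneIso.inv_hom_id)

/-- The lift takes its base from `a` and its section from `b`; the fibres agree because the square
of `d` is a pullback. -/
lemma exists_cart_lift {X Y : Over I} (g : X ⟶ Y) {W : C} (a : W ⟶ (d.mid.ext.obj Y).left)
    (b : W ⟶ (F.ext.obj X).left)
    (hab : a ≫ (d.cart.app Y).left = b ≫ (F.ext.map g).left) :
    ∃ z : W ⟶ (d.mid.ext.obj X).left, z ≫ (d.mid.ext.map g).left = a ∧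
      z ≫ (d.cart.app X).left = b := by
  have hbase : b ≫ F.base X = a ≫ d.mid.base Y ≫ d.α := by
    rw [← d.cart_base, ← Category.assoc, hab, Category.assoc, Poly.map_base]
  have sq := pb_isPullback d.p (Over.mk (a ≫ d.mid.base Y))
  set e : ((pb d.p).obj (Over.mk (a ≫ d.mid.base Y))).left ⟶ d.E := Over.hom _
  set q : _ ⟶ W := pbFst d.p (Over.mk (a ≫ d.mid.base Y))
  have hqe : q ≫ a ≫ d.mid.base Y = e ≫ d.p := sq.w.symm
  have h₁ : (q ≫ b) ≫ F.base X = (e ≫ d.β) ≫ F.f := by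
    rw [Category.assoc, hbase, Category.assoc, d.isPullback.w, ← Category.assoc e, ← hqe]
    simp only [Category.assoc]
  obtain ⟨z, hz, hev⟩ := Poly.exists_hom (F := d.mid) (X := X) _ sq
    (F.ev X (q ≫ b) (e ≫ d.β) h₁) (by
      rw [Poly.ev_hom, Category.assoc, ← d.w_s])
  have hz' : z ≫ d.mid.base X = a ≫ d.mid.base Y := hz
  refine ⟨z, ?_, ?_⟩
  · have hg : (z ≫ (d.mid.ext.map g).left) ≫ d.mid.base Y = a ≫ d.mid.base Y := by
      rw [Category.assoc, Poly.map_base, hz']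
    refine Poly.hom_ext_of_isPullback (b := e) (q := q) (by rw [hg]; exact sq) hg ?_
    have h₂ : (q ≫ z) ≫ d.mid.base X = e ≫ d.p := by rw [Category.assoc, hz', hqe]
    have h₃ : (q ≫ a) ≫ d.mid.base Y = e ≫ d.p := by rw [Category.assoc, hqe]
    rw [Poly.ev_congr (Category.assoc _ _ _).symm rfl, Poly.ev_map g _ _ h₂, hev,
      ← Poly.ev_map g _ _ h₁ (by rw [Category.assoc, Poly.map_base, h₁]),
      ← d.ev_cart (q ≫ a) e h₃ (by
        rw [Category.assoc, cart_base, ← Category.assoc, h₃, Category.assoc, Category.assoc,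
          d.isPullback.w])]
    exact Poly.ev_congr (by rw [Category.assoc, Category.assoc, hab]) rfl
  · have hb : (z ≫ (d.cart.app X).left) ≫ F.base X = (a ≫ d.mid.base Y) ≫ d.α := by
      rw [Category.assoc, cart_base, ← Category.assoc, hz']
    refine Poly.hom_ext_of_isPullback (b := e ≫ d.β) (q := q) ?_ (by
      rw [hb, hbase, Category.assoc]) ?_
    · rw [hb]
      -- Pasting makes the fibre of `p` over `W` also the fibre of `f` over `W`, so equality may be
      -- tested there.
      exact (sq.flip.paste_vert d.isPullback.flip).flip
    · rw [Poly.ev_congr (Category.assoc _ _ _).symm rfl, d.ev_cart]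
      exact hev

lemma cart_lift_unique {X Y : Over I} (g : X ⟶ Y) {W : C} {z z' : W ⟶ (d.mid.ext.obj X).left}
    (h₁ : z ≫ (d.mid.ext.map g).left = z' ≫ (d.mid.ext.map g).left)
    (h₂ : z ≫ (d.cart.app X).left = z' ≫ (d.cart.app X).left) : z = z' := by
  have hb : z ≫ d.mid.base X = z' ≫ d.mid.base X := by
    rw [← Poly.map_base g, ← Category.assoc, h₁, Category.assoc]
  refine Poly.hom_ext hb fun P e q hq hq' => ?_
  have hc : ∀ y : P ⟶ (d.mid.ext.obj X).left, y ≫ d.mid.base X = e ≫ d.p →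
      (y ≫ (d.cart.app X).left) ≫ F.base X = (e ≫ d.β) ≫ F.f := fun y hy => by
    rw [Category.assoc, cart_base, ← Category.assoc, hy, Category.assoc, Category.assoc,
      d.isPullback.w]
  rw [← d.ev_cart _ e hq (hc _ hq), ← d.ev_cart _ e hq' (hc _ hq')]
  exact Poly.ev_congr (by rw [Category.assoc, Category.assoc, h₂]) rfl

lemma equifibered_cart : NatTrans.Equifibered d.cart := by
  intro X Y g
  refine ⟨⟨d.cart.naturality g⟩, ⟨Limits.PullbackCone.IsLimit.mk _
    (fun c => Over.homMk (d.exists_cart_lift g c.fst.left c.snd.left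
      (congrArg (fun k => Over.Hom.left k) c.condition)).choose ?_) ?_ ?_ ?_⟩⟩
  · rw [← Over.w c.fst, ← Over.w (d.mid.ext.map g), ← Category.assoc]
    exact congrArg (· ≫ _) (d.exists_cart_lift g c.fst.left c.snd.left
      (congrArg (fun k => Over.Hom.left k) c.condition)).choose_spec.1
  · intro c
    apply Over.OverMorphism.ext
    exact (d.exists_cart_lift g c.fst.left c.snd.left
      (congrArg (fun k => Over.Hom.left k) c.condition)).choose_spec.1
  · intro c
    apply Over.OverMorphism.ext
    exact (d.exists_cart_lift g c.fst.left c.snd.left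
      (congrArg (fun k => Over.Hom.left k) c.condition)).choose_spec.2
  · intro c m h₁ h₂
    have hs := (d.exists_cart_lift g c.fst.left c.snd.left
      (congrArg (fun k => Over.Hom.left k) c.condition)).choose_spec
    apply Over.OverMorphism.ext
    apply d.cart_lift_unique g
    · exact (congrArg (fun k => Over.Hom.left k) h₁).trans hs.1.symm
    · exact (congrArg (fun k => Over.Hom.left k) h₂).trans hs.2.symm

end

section

variable {C : Type u} [Category.{v} C] [CartesianMonoidalCategory C] [ChosenPullbacks C]
  [LocallyCartesianClosed C] {I J : C} {G F : Poly I J} (d : PolyMor G F)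

lemma isStrong_vert : IsStrong G.strength d.mid.strength d.vert := by
  intro K X
  apply Over.OverMorphism.ext
  change (G.strength.app K X).left ≫ (d.vert.app (tens K X)).left =
    (𝟙 K ⊗ₘ (d.vert.app X).left) ≫ (d.mid.strength.app K X).left
  have hs : (𝟙 K ⊗ₘ (d.vert.app X).left) ≫ snd _ _ ≫ d.mid.base X = snd _ _ ≫ G.base X := by
    rw [← Category.assoc, tensorHom_snd, Category.assoc, vert_base]
  refine Poly.hom_ext ?_ fun P e q hq hq' => ?_
  · rw [Category.assoc, Category.assoc, vert_base, Poly.strength_base, Poly.strength_base, hs]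
  · have h₀ : (q ≫ snd _ _) ≫ G.base X = (e ≫ d.w) ≫ G.f := by
      simpa [Poly.strength_base, hs, vert_base, d.w_f] using hq'
    rw [Poly.ev_congr (Category.assoc _ _ _).symm rfl, d.ev_vert _ e (by
        rw [Category.assoc, Poly.strength_base, ← Category.assoc, h₀]),
      Poly.ev_strength q _ h₀,
      Poly.ev_congr (Category.assoc q (𝟙 K ⊗ₘ (d.vert.app X).left) _).symm rfl,
      Poly.ev_strength _ e (by
        rw [Category.assoc, Category.assoc, hs, ← Category.assoc, h₀, Category.assoc, d.w_f])]
    congr 1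
    · simp
    · rw [← d.ev_vert _ e h₀ (by
        rw [Category.assoc, vert_base, h₀, Category.assoc, d.w_f])]
      exact Poly.ev_congr (by simp) rfl

lemma isStrong_cart : IsStrong d.mid.strength F.strength d.cart := by
  intro K X
  apply Over.OverMorphism.ext
  change (d.mid.strength.app K X).left ≫ (d.cart.app (tens K X)).left =
    (𝟙 K ⊗ₘ (d.cart.app X).left) ≫ (F.strength.app K X).left
  have hs : (𝟙 K ⊗ₘ (d.cart.app X).left) ≫ snd _ _ ≫ F.base X =
      snd _ _ ≫ d.mid.base X ≫ d.α := by
    rw [← Category.assoc, tensorHom_snd, Category.assoc, cart_base]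
  refine Poly.hom_ext ?_ fun P b q hq hq' => ?_
  · rw [Category.assoc, Category.assoc, cart_base, Poly.strength_base, hs, ← Category.assoc,
      Poly.strength_base, Category.assoc]
  · have h₁ : b ≫ F.f = (q ≫ snd _ _ ≫ d.mid.base X) ≫ d.α := by
      rw [← hq', Category.assoc, Category.assoc, Poly.strength_base, hs]
      simp
    -- `ev_cart` evaluates only at points coming from `E`; by the pullback property every point of
    -- the relevant fibre of `f` is of this kind.
    obtain ⟨e, rfl, he⟩ := d.isPullback.exists_lift b (q ≫ snd _ _ ≫ d.mid.base X) h₁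
    have h₀ : (q ≫ snd _ _) ≫ d.mid.base X = e ≫ d.p := by rw [he, Category.assoc]
    rw [Poly.ev_congr (Category.assoc _ _ _).symm rfl, d.ev_cart _ e (by
        rw [Category.assoc, Poly.strength_base, ← Category.assoc, h₀]),
      Poly.ev_strength q _ h₀,
      Poly.ev_congr (Category.assoc q (𝟙 K ⊗ₘ (d.cart.app X).left) _).symm rfl,
      Poly.ev_strength _ (e ≫ d.β) (by
        rw [Category.assoc, Category.assoc, hs, h₁]; simp)]
    congr 1
    · simp
    · rw [← d.ev_cart _ e h₀ (by rw [Category.assoc, cart_base, h₁]; simp)]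
      exact Poly.ev_congr (by simp) rfl

end

end PolyMor

/-! ### The generic element and the representation of strong transformations. -/

namespace Poly

section

variable {C : Type u} [Category.{v} C] [ChosenPullbacks C] [LocallyCartesianClosed C] {I J : C}
  (G : Poly I J)

lemma exists_generic : ∃ z : G.A ⟶ (G.ext.obj (Over.mk G.s)).left, ∃ hz : z ≫ G.base _ = 𝟙 G.A,
    G.ev (Over.mk G.s) (G.f ≫ z) (𝟙 G.B) (by simp [hz]) = 𝟙 G.B :=
  exists_hom (X := Over.mk G.s) (𝟙 G.A) (IsPullback.of_horiz_isIso ⟨by simp⟩) (𝟙 G.B) rfl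

/-- The generic element of the extension of `G` at `G.s`. -/
noncomputable def generic : G.A ⟶ (G.ext.obj (Over.mk G.s)).left := G.exists_generic.choose

@[simp]
lemma generic_base : G.generic ≫ G.base _ = 𝟙 G.A := G.exists_generic.choose_spec.choose

lemma ev_generic {P : C} (c : P ⟶ G.A) (b : P ⟶ G.B)
    (h : (c ≫ G.generic) ≫ G.base _ = b ≫ G.f) :
    G.ev (Over.mk G.s) (c ≫ G.generic) b h = b := by
  have h' : c = b ≫ G.f := by simpa using h
  subst h'
  have := congrArg (b ≫ ·) G.exists_generic.choose_spec.choose_spec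
  rw [comp_ev] at this
  refine Eq.trans (ev_congr (by simp; rfl) (by simp)) (this.trans (Category.comp_id b))

variable {G}

/-- By naturality along `X ⟶ 1` the base of `φ` factors through its component at the terminal
object, where an element is nothing but its base. No strength is needed. -/
lemma exists_base_comp {F : Poly I J} (φ : G.ext ⟶ F.ext) :
    ∃ α : G.A ⟶ F.A, α ≫ F.t = G.t ∧
      ∀ X : Over I, (φ.app X).left ≫ F.base X = G.base X ≫ α := by
  have key : ∀ X : Over I, (φ.app X).left ≫ F.base X =
      (G.ext.map (Over.mkIdTerminal.from X)).left ≫ (φ.app (Over.mk (𝟙 I))).left ≫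
        F.base (Over.mk (𝟙 I)) := by
    intro X
    rw [← map_base (Over.mkIdTerminal.from X), ← Category.assoc, ← Category.assoc,
      ← Over.comp_left, ← Over.comp_left, φ.naturality]
  refine ⟨G.generic ≫ (φ.app (Over.mk G.s)).left ≫ F.base _, ?_, fun X => ?_⟩
  · rw [Category.assoc, Category.assoc, base_t, Over.w, ← base_t, ← Category.assoc, generic_base,
      Category.id_comp]
  · rw [key X, key (Over.mk G.s)]
    simp only [← Category.assoc]
    congr 2
    refine hom_ext ?_ fun P b q hq hq' => ?_
    · rw [map_base, Category.assoc, Category.assoc, map_base, generic_base, Category.comp_id]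
    · have h₁ := ev_hom _ _ hq
      have h₂ := ev_hom _ _ hq'
      exact (Category.comp_id _).symm.trans ((h₁.trans h₂.symm).trans (Category.comp_id _))

end

section

variable {C : Type u} [Category.{v} C] [CartesianMonoidalCategory C] [ChosenPullbacks C]
  [LocallyCartesianClosed C] {I J : C} {G F : Poly I J}

/-- A strong transformation is determined by its value at the generic element. -/
lemma ev_app_of_isStrong {φ : G.ext ⟶ F.ext} (hφ : IsStrong G.strength F.strength φ)
    {α : G.A ⟶ F.A} (hα : ∀ X : Over I, (φ.app X).left ≫ F.base X = G.base X ≫ α)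
    {X : Over I} {Z P : C} (z : Z ⟶ (G.ext.obj X).left) (q : P ⟶ Z) (c : P ⟶ G.A)
    (hc : q ≫ z ≫ G.base X = c) (b : P ⟶ F.B) (hb : c ≫ α = b ≫ F.f) (w : P ⟶ G.B)
    (hw : F.ev (Over.mk G.s) (c ≫ G.generic ≫ (φ.app (Over.mk G.s)).left) b (by
      rw [Category.assoc, Category.assoc, hα, ← Category.assoc G.generic, generic_base,
        Category.id_comp, hb]) = w) :
    ∃ h : (q ≫ z) ≫ G.base X = w ≫ G.f,
      F.ev X (q ≫ z ≫ (φ.app X).left) b (by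
        rw [Category.assoc, Category.assoc, hα, ← hb, ← hc]; simp) = G.ev X (q ≫ z) w h := by
  -- `R` is the fibre of `G.f` over `Z`, with projections `π` to `Z` and `δ` to `G.B`.
  have sq := pb_isPullback G.f (Over.mk (z ≫ G.base X))
  set R : C := ((pb G.f).obj (Over.mk (z ≫ G.base X))).left
  set δ : R ⟶ G.B := Over.hom _
  set π : R ⟶ Z := pbFst G.f (Over.mk (z ≫ G.base X))
  have hπ : π ≫ z ≫ G.base X = δ ≫ G.f := sq.w.symm
  have hπ' : (π ≫ z) ≫ G.base X = δ ≫ G.f := by rw [Category.assoc, hπ]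
  -- The tautological element `u` has the identity of `R` as section. The section `m` of `z` maps
  -- `u` to `z`, while the embedding `ι` of `R` in `Z × G.B` maps it to an element built from
  -- `G.generic` by the strength.
  obtain ⟨u, hu, hev⟩ := exists_hom (X := Over.mk (δ ≫ G.s)) _ sq (𝟙 R) (Category.id_comp _)
  replace hu : u ≫ G.base _ = z ≫ G.base X := hu
  have hπu : (π ≫ u) ≫ G.base _ = δ ≫ G.f := by rw [Category.assoc, hu, hπ]
  let m : Over.mk (δ ≫ G.s) ⟶ X := Over.homMk (G.ev X (π ≫ z) δ hπ') (ev_hom _ _ _)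
  let ι : Over.mk (δ ≫ G.s) ⟶ tens Z (Over.mk G.s) := Over.homMk (lift π δ) (by simp)
  have hm : u ≫ (G.ext.map m).left = z := by
    have h₁ : (u ≫ (G.ext.map m).left) ≫ G.base X = z ≫ G.base X := by
      rw [Category.assoc, map_base, hu]
    refine hom_ext_of_isPullback (b := δ) (q := π) (by rw [h₁]; exact sq) h₁ ?_
    rw [ev_congr (Category.assoc _ _ _).symm rfl, ev_map m _ _ hπu, hev]
    exact Category.id_comp _
  have hι : u ≫ (G.ext.map ι).left =
      lift (𝟙 Z) ((z ≫ G.base X) ≫ G.generic) ≫ (G.strength.app Z (Over.mk G.s)).left := by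
    have h₁ : (u ≫ (G.ext.map ι).left) ≫ G.base _ = z ≫ G.base X := by
      rw [Category.assoc, map_base, hu]
    refine hom_ext_of_isPullback (b := δ) (q := π) (by rw [h₁]; exact sq) ?_ ?_
    · rw [h₁, Category.assoc, strength_base]
      simp
    · rw [ev_congr (Category.assoc _ _ _).symm rfl, ev_map ι _ _ hπu, hev,
        ev_congr (Category.assoc π _ _).symm rfl, ev_strength _ _ (by simpa using hπ)]
      refine (Category.id_comp _).trans ?_
      apply CartesianMonoidalCategory.hom_ext
      · simp [ι]
      · rw [lift_snd, ev_congr (y' := (π ≫ z ≫ G.base X) ≫ G.generic) (by simp) rfl, ev_generic]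
        simp [ι]
  have hqu : (q ≫ u ≫ (φ.app _).left) ≫ F.base _ = b ≫ F.f := by
    rw [Category.assoc, Category.assoc, hα, ← Category.assoc u, hu, ← hb, ← hc]
    simp
  have nat : ∀ {Y : Over I} (k : Over.mk (δ ≫ G.s) ⟶ Y),
      (G.ext.map k).left ≫ (φ.app Y).left = (φ.app _).left ≫ (F.ext.map k).left := fun k => by
    rw [← Over.comp_left, ← Over.comp_left, φ.naturality]
  have hst : (G.strength.app Z (Over.mk G.s)).left ≫ (φ.app _).left =
      (𝟙 Z ⊗ₘ (φ.app (Over.mk G.s)).left) ≫ (F.strength.app Z (Over.mk G.s)).left :=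
    congrArg (fun k => Over.Hom.left k) (hφ Z (Over.mk G.s))
  -- The value `n` of `φ u` at `b` is a point of `R`. Pushing it along `ι` determines its
  -- coordinates as `q` and `w`; pushing it along `m` gives the value of `φ z`.
  obtain ⟨n, hn⟩ : ∃ n, n = F.ev _ (q ≫ u ≫ (φ.app _).left) b hqu := ⟨_, rfl⟩
  have hmap : ∀ {Y : Over I} (k : Over.mk (δ ≫ G.s) ⟶ Y),
      n ≫ k.left = F.ev Y (q ≫ (u ≫ (G.ext.map k).left) ≫ (φ.app Y).left) b (by
        rw [← hqu, Category.assoc u, nat]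
        simp only [Category.assoc, map_base]) := fun k => by
    rw [hn, ← ev_map k _ _ hqu (by rw [Category.assoc, map_base, hqu])]
    refine ev_congr ?_ rfl
    rw [Category.assoc, Category.assoc, Category.assoc, nat]
  have hnι : n ≫ lift π δ = lift q w := by
    refine (hmap ι).trans ?_
    have hs : q ≫ (u ≫ (G.ext.map ι).left) ≫ (φ.app _).left =
        lift q (c ≫ G.generic ≫ (φ.app _).left) ≫ (F.strength.app Z (Over.mk G.s)).left := by
      rw [hι, Category.assoc, hst, ← Category.assoc, ← Category.assoc]
      congr 1
      rw [← hc]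
      simp
    rw [ev_congr hs rfl, ev_strength _ _ (by
      rw [lift_snd, Category.assoc, Category.assoc, hα, ← Category.assoc G.generic, generic_base,
        Category.id_comp, hb]), lift_fst]
    congr 1
    exact (ev_congr (by simp) rfl).trans hw
  have hnπ : n ≫ π = q := by
    simpa using congrArg (· ≫ fst _ _) hnι
  have hnδ : n ≫ δ = w := by
    simpa using congrArg (· ≫ snd _ _) hnι
  -- Since `n` lies in `R`, its coordinates `q` and `w` have the same image in `G.A`: this is where
  -- `w` is forced into the right fibre.
  have h : (q ≫ z) ≫ G.base X = w ≫ G.f := by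
    rw [← hnδ, Category.assoc, Category.assoc n, ← hπ, ← hnπ]
    simp
  refine ⟨h, ?_⟩
  have h₂ := hmap m
  rw [ev_congr (by rw [hm]) rfl] at h₂
  rw [← h₂]
  refine (comp_ev n (π ≫ z) δ hπ').trans (ev_congr ?_ hnδ)
  rw [← Category.assoc, hnπ]

lemma exists_represents {φ : G.ext ⟶ F.ext} (hφ : IsStrong G.strength F.strength φ) :
    ∃ d : PolyMor G F, d.vert ≫ d.cart = φ := by
  obtain ⟨α, hαt, hα⟩ := exists_base_comp φ
  have sq := pb_isPullback F.f (Over.mk α)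
  set E : C := ((pb F.f).obj (Over.mk α)).left
  set β : E ⟶ F.B := Over.hom _
  set p : E ⟶ G.A := pbFst F.f (Over.mk α)
  replace sq : IsPullback β p F.f α := sq
  have hgen : (G.generic ≫ (φ.app (Over.mk G.s)).left) ≫ F.base _ = α := by
    rw [Category.assoc, hα, ← Category.assoc, generic_base, Category.id_comp]
  have hw₀ : (p ≫ G.generic ≫ (φ.app (Over.mk G.s)).left) ≫ F.base _ = β ≫ F.f := by
    rw [Category.assoc, hgen, sq.w]
  obtain ⟨w, hw⟩ : ∃ w, w = F.ev _ _ β hw₀ := ⟨_, rfl⟩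
  have hwe : ∀ {P : C} (e : P ⟶ E), F.ev (Over.mk G.s)
      ((e ≫ p) ≫ G.generic ≫ (φ.app (Over.mk G.s)).left) (e ≫ β) (by
        rw [Category.assoc, hgen, Category.assoc, Category.assoc, sq.w]) = e ≫ w := fun e => by
    rw [hw, comp_ev]
    exact ev_congr (Category.assoc _ _ _) rfl
  have hwf : w ≫ G.f = p := by
    -- Applied to the generic element itself, only the fibre condition on `w` is used.
    obtain ⟨h, -⟩ := ev_app_of_isStrong hφ hα G.generic p p (by simp) β sq.w.symm w
      (by rw [hw])
    rw [← h]; simp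
  let d : PolyMor G F :=
    { E := E, p := p, w := w, β := β, α := α, w_f := hwf, isPullback := sq, α_t := hαt
      w_s := by
        rw [hw]
        exact ev_hom _ _ hw₀ }
  refine ⟨d, ?_⟩
  ext X : 2
  apply Over.OverMorphism.ext
  rw [NatTrans.comp_app, Over.comp_left]
  have hd : (d.vert.app X).left ≫ (d.cart.app X).left ≫ F.base X = G.base X ≫ α := by
    rw [d.cart_base, ← Category.assoc, d.vert_base]
  refine hom_ext (by rw [Category.assoc, hd, hα]) fun P b q hq hq' => ?_
  obtain ⟨e, rfl, he⟩ := sq.exists_lift b (q ≫ G.base X) (by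
    rw [← hq', Category.assoc, hα, Category.assoc])
  -- Now the element `z` is the universal one, the identity of the total object of `G.ext.obj X`.
  obtain ⟨h, hev⟩ := ev_app_of_isStrong hφ hα (𝟙 _) q (e ≫ p) (by simp [he]) (e ≫ β)
    (by rw [Category.assoc, Category.assoc, sq.w]) (e ≫ w) (hwe e)
  rw [Category.comp_id] at h
  rw [ev_congr (Category.assoc _ _ _).symm rfl,
    d.ev_cart (q ≫ (d.vert.app X).left) e (by
      rw [Category.assoc, d.vert_base]; exact he.symm), d.ev_vert q e h]
  refine Eq.trans (ev_congr (Category.comp_id q).symm rfl) (hev.symm.trans (ev_congr ?_ rfl))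
  rw [Category.id_comp]

end

end Poly

/-! ### Essential uniqueness of the representing morphism. -/

namespace PolyMor

variable {C : Type u} [Category.{v} C] [ChosenPullbacks C] [LocallyCartesianClosed C] {I J : C}
  {G F : Poly I J}

lemma app_generic_base (d : PolyMor G F) :
    G.generic ≫ ((d.vert ≫ d.cart).app (Over.mk G.s)).left ≫ F.base _ = d.α := by
  rw [NatTrans.comp_app, Over.comp_left, Category.assoc, cart_base, ← Category.assoc _ _ d.α,
    vert_base, ← Category.assoc, Poly.generic_base, Category.id_comp]

/-- This recovers `w` from the represented transformation, as `app_generic_base` recovers `α`. -/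
lemma ev_app_generic (d : PolyMor G F) {P : C} (e : P ⟶ d.E)
    (h : ((e ≫ d.p) ≫ G.generic ≫ ((d.vert ≫ d.cart).app (Over.mk G.s)).left) ≫ F.base _ =
      (e ≫ d.β) ≫ F.f) :
    F.ev _ ((e ≫ d.p) ≫ G.generic ≫ ((d.vert ≫ d.cart).app (Over.mk G.s)).left) (e ≫ d.β) h =
      e ≫ d.w := by
  have h₁ : ((e ≫ d.p) ≫ G.generic) ≫ G.base _ = (e ≫ d.w) ≫ G.f := by
    rw [Category.assoc, Poly.generic_base, Category.comp_id, Category.assoc, d.w_f]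
  rw [Poly.ev_congr (y' := (((e ≫ d.p) ≫ G.generic) ≫ (d.vert.app (Over.mk G.s)).left) ≫
      (d.cart.app (Over.mk G.s)).left) (by simp) rfl,
    d.ev_cart _ e (by rw [Category.assoc, vert_base, h₁, Category.assoc, d.w_f]),
    d.ev_vert _ e h₁, Poly.ev_generic]

lemma existsUnique_iso {d d' : PolyMor G F} (h : d'.vert ≫ d'.cart = d.vert ≫ d.cart) :
    ∃! e : d.E ≅ d'.E, d.IsIsoOfDiagrams d' e := by
  have hα : d.α = d'.α := by rw [← app_generic_base, ← app_generic_base, h]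
  have sq : IsPullback d'.β d'.p F.f d.α := hα ▸ d'.isPullback
  let e := d.isPullback.isoIsPullback _ _ sq
  have hp : e.hom ≫ d'.p = d.p := d.isPullback.isoIsPullback_hom_snd _ _ sq
  have hβ : e.hom ≫ d'.β = d.β := d.isPullback.isoIsPullback_hom_fst _ _ sq
  -- Compatibility with `p` and `β` already pins down `e`, as both middle objects are pullbacks of
  -- the same pair; compatibility with `w` follows because both maps `w` are values of the same
  -- transformation.
  refine ⟨e, ⟨hp, ?_, hβ, hα⟩, fun e' he' => ?_⟩
  · have hb : ∀ {P : C} (k : P ⟶ d'.E),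
        ((k ≫ d'.p) ≫ G.generic ≫ ((d'.vert ≫ d'.cart).app (Over.mk G.s)).left) ≫ F.base _ =
          (k ≫ d'.β) ≫ F.f := fun k => by
      rw [Category.assoc, Category.assoc G.generic, app_generic_base, Category.assoc,
        Category.assoc, d'.isPullback.w]
    have hb' : ((𝟙 _ ≫ d.p) ≫ G.generic ≫ ((d.vert ≫ d.cart).app (Over.mk G.s)).left) ≫
        F.base _ = (𝟙 _ ≫ d.β) ≫ F.f := by
      rw [Category.assoc, Category.assoc G.generic, app_generic_base, Category.assoc,
        Category.assoc, d.isPullback.w]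
    rw [← d'.ev_app_generic e.hom (hb e.hom), ← Category.id_comp d.w, ← d.ev_app_generic _ hb']
    exact Poly.ev_congr (by rw [hp, h, Category.id_comp]) (by rw [hβ, Category.id_comp])
  · ext
    apply sq.hom_ext
    · rw [he'.β, hβ]
    · rw [he'.p, hp]

end PolyMor

end PolyFun

theorem mainTheorem4 {C : Type*} [Category* C] [CartesianMonoidalCategory C] [ChosenPullbacks C]
    [PolyFun.LocallyCartesianClosed C] {I J : C} (G F : PolyFun.Poly I J) :
    (∀ d : PolyFun.PolyMor G F,
      (PolyFun.IsStrong G.strength d.mid.strength d.vert ∧ PolyFun.IsVertical d.vert) ∧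
      (PolyFun.IsStrong d.mid.strength F.strength d.cart ∧ NatTrans.Equifibered d.cart) ∧
      PolyFun.IsStrong G.strength F.strength (d.vert ≫ d.cart)) ∧
    ∀ φ : G.ext ⟶ F.ext, PolyFun.IsStrong G.strength F.strength φ →
      ∃ d : PolyFun.PolyMor G F, d.vert ≫ d.cart = φ ∧
        ∀ d' : PolyFun.PolyMor G F, d'.vert ≫ d'.cart = φ →
          ∃! e : d.E ≅ d'.E, d.IsIsoOfDiagrams d' e := by
  refine ⟨fun d => ⟨⟨d.isStrong_vert, d.isVertical_vert⟩, ⟨d.isStrong_cart, d.equifibered_cart⟩,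
    d.isStrong_vert.comp d.isStrong_cart⟩, fun φ hφ => ?_⟩
  obtain ⟨d, rfl⟩ := PolyFun.Poly.exists_represents hφ
  exact ⟨d, rfl, fun d' h => PolyFun.PolyMor.existsUnique_iso h⟩
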